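/- Consider the following surfaces in $\mathbb{R}^3$: a) $\mathcal H_a=\{xyz=1,\ x>0,\ y>0\}$, b) $\mathcal H_b=\{x(xy-z^2)=1,\ x>0\}$, c) $\mathcal H_c=\{x(yz+x^2)=1,\ x<0,\ y>0\}$, d) $\mathcal H_d=\{z(x^2+y^2-z^2)=1,\ z<0\}$, e) $\mathcal H_e=\{x(y^2-z^2)+y^3=1,\ y<0,\ x>0\}$. For $s\in\{a,b,c,d,e\}$ let $h_s$ be the homogeneous cubic polynomial in the defining equation $h_s=1$ of $\mathcal H_s$, let $U_s=\mathbb{R}_{>0}\cdot\mathcal H_s\subset\mathbb{R}^3$ be the cone over $\mathcal H_s$, and let $M_s=\mathbb{R}^3+iU_s\subset\mathbb{C}^3$. The supergravity r-map assigns to $\mathcal H_s$ the manifold $(M_s,g_s)$ with the metric $g_s=2\sum_{\mu,\nu} g_{\mu\bar\nu}\,dz^\mu d\bar z^\nu$ given by the Kähler potential $-\log h_s(\operatorname{Im}z)$, that is, $$g_{\mu\bar\nu}(z)=-\frac{\partial_\mu\partial_\nu h_s(x)}{4h_s(x)}+\frac{\partial_\mu h_s(x)\,\partial_\nu h_s(x)}{4h_s(x)^2},\qquad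 x=\operatorname{Im}z .$$ As a real metric, with $z=y+ix$, this is $g_s=2\sum_{\mu,\nu} g_{\mu\bar\nu}(dy^\mu\otimes dy^\nu+dx^\mu\otimes dx^\nu)$. Let $\mathrm{scal}_s:M_s\to\mathbb{R}$ be the scalar curvature of $g_s$, normalized as one half of the trace of the Ricci tensor. Then each $M_s$ is open in $\mathbb{C}^3$ and $g_s$ is a (smooth, positive definite) Riemannian metric on $M_s$; the five Riemannian manifolds $(M_s,g_s)$ are pairwise non-isometric, where an isometry is a smooth diffeomorphism pulling one metric back to the other; and the images of their scalar curvature functions satisfy $$\mathrm{scal}_a(M_a)=\{-6\},\quad \mathrm{scal}_b(M_b)=\left\{-\tfrac{15}{2}\right\},\quad \mathrm{scal}_c(M_c)=\left(-\tfrac{15}{2},-6\right),$$ $$\mathrm{scal}_d(M_d)=\left[-\tfrac{26}{3},-\tfrac{15}{2}\right),\quad [-8,-6)\subset\mathrm{scal}_e(M_e).$$ -/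

import Mathlib

set_option maxSynthPendingDepth 3

open scoped ContDiff

noncomputable section

namespace RMap

/-! ### Riemannian geometry on an open subset of a real vector space

A metric is given by a map `g : E → E →L[ℝ] E →L[ℝ] ℝ`, of which only the values on an open
set `M ⊆ E` matter. Vector fields are identified with `E`-valued maps by means of the global
linear chart. -/

section Riemannian

variable {E : Type*} [NormedAddCommGroup E] [NormedSpace ℝ E]

/-- `(M, g)` is a Riemannian manifold: `M` is an open subset of `E` and `g` is a smooth,
symmetric and positive definite tensor field on `M`. -/
structure IsRiemannian (M : Set E) (g : E → E →L[ℝ] E →L[ℝ] ℝ) : Prop where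
  isOpen : IsOpen M
  contDiffOn : ContDiffOn ℝ ∞ g M
  symm : ∀ p ∈ M, ∀ v w, g p v w = g p w v
  pos : ∀ p ∈ M, ∀ v, v ≠ 0 → 0 < g p v v

/-- `(M, g)` and `(M', g')` are isometric: there is a smooth diffeomorphism `φ : M → M'`
(with inverse `ψ`) such that `φ^* g' = g`. -/
def Isometric {E' : Type*} [NormedAddCommGroup E'] [NormedSpace ℝ E']
    (M : Set E) (g : E → E →L[ℝ] E →L[ℝ] ℝ)
    (M' : Set E') (g' : E' → E' →L[ℝ] E' →L[ℝ] ℝ) : Prop :=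
  ∃ (φ : E → E') (ψ : E' → E),
    Set.MapsTo φ M M' ∧ Set.MapsTo ψ M' M ∧
    Set.LeftInvOn ψ φ M ∧ Set.RightInvOn ψ φ M' ∧
    ContDiffOn ℝ ∞ φ M ∧ ContDiffOn ℝ ∞ ψ M' ∧
    ∀ p ∈ M, ∀ v w, g' (φ p) (fderiv ℝ φ p v) (fderiv ℝ φ p w) = g p v w

/-- Christoffel symbols of the first kind:
`christoffelLower g p v w u = (1/2) * ((∂_v g)(w, u) + (∂_w g)(v, u) - (∂_u g)(v, w))`. -/
def christoffelLower (g : E → E →L[ℝ] E →L[ℝ] ℝ) (p : E) : E →L[ℝ] E →L[ℝ] E →L[ℝ] ℝ :=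
  let dg : E →L[ℝ] E →L[ℝ] E →L[ℝ] ℝ := fderiv ℝ g p
  let dg' : E →L[ℝ] E →L[ℝ] E →L[ℝ] ℝ :=
    (ContinuousLinearMap.flipₗᵢ ℝ E E ℝ).toContinuousLinearEquiv.toContinuousLinearMap.comp
      dg.flip
  (1 / 2 : ℝ) • (dg + dg.flip - dg')

theorem christoffelLower_apply (g : E → E →L[ℝ] E →L[ℝ] ℝ) (p v w u : E) :
    christoffelLower g p v w u =
      (1 / 2) * (fderiv ℝ g p v w u + fderiv ℝ g p w v u - fderiv ℝ g p u v w) := rfl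

/-- Christoffel symbols of the second kind, `christoffel g p v w = Γ_p(v, w)`, i.e. the
Levi-Civita connection of `g` is `∇_V W = ∂_V W + Γ(V, W)`. Here `(g p).inverse` is the inverse
of the isomorphism `E → E^*` given by the metric at `p`. -/
def christoffel (g : E → E →L[ℝ] E →L[ℝ] ℝ) (p : E) : E →L[ℝ] E →L[ℝ] E :=
  (ContinuousLinearMap.compL ℝ E (E →L[ℝ] ℝ) E (g p).inverse).comp (christoffelLower g p)

theorem christoffel_apply (g : E → E →L[ℝ] E →L[ℝ] ℝ) (p v w : E) :
    christoffel g p v w = (g p).inverse (christoffelLower g p v w) := rfl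

/-- The Riemann curvature tensor `R(u, v) = ∇_u ∇_v - ∇_v ∇_u` (for constant fields `u`, `v`). -/
def riemann (g : E → E →L[ℝ] E →L[ℝ] ℝ) (p u v : E) : E →L[ℝ] E :=
  fderiv ℝ (christoffel g) p u v - fderiv ℝ (christoffel g) p v u
    + (christoffel g p u).comp (christoffel g p v)
    - (christoffel g p v).comp (christoffel g p u)

/-- The endomorphism `u ↦ R(u, v) w`. -/
def riemannEnd (g : E → E →L[ℝ] E →L[ℝ] ℝ) (p v w : E) : E →ₗ[ℝ] E where
  toFun u := riemann g p u v w
  map_add' a b := by simp [riemann]; abel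
  map_smul' c a := by simp [riemann, smul_sub, smul_add]

/-- The Ricci tensor `Ric(v, w) = tr (u ↦ R(u, v) w)`. -/
def ricci (g : E → E →L[ℝ] E →L[ℝ] ℝ) (p : E) : E →ₗ[ℝ] E →ₗ[ℝ] ℝ :=
  LinearMap.mk₂ ℝ (fun v w => LinearMap.trace ℝ E (riemannEnd g p v w))
    (fun a b w => by
      rw [← map_add]; congr 1; ext u; simp [riemannEnd, riemann]; abel)
    (fun c a w => by
      rw [← map_smul]; congr 1; ext u; simp [riemannEnd, riemann, smul_sub, smul_add])
    (fun v a b => by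
      rw [← map_add]; congr 1; ext u; simp [riemannEnd, riemann]; abel)
    (fun c v a => by
      rw [← map_smul]; congr 1; ext u; simp [riemannEnd, riemann, smul_sub, smul_add])

/-- The scalar curvature in the normalization used for Kähler manifolds: one half of the trace
of the Ricci tensor with respect to the metric,
`scal = (1/2) tr_g Ric = g^{μ \bar ν} Ric_{μ \bar ν}`. -/
def scal [FiniteDimensional ℝ E] (g : E → E →L[ℝ] E →L[ℝ] ℝ) (p : E) : ℝ :=
  (1 / 2) * LinearMap.trace ℝ E
    (((g p).inverse : (E →L[ℝ] ℝ) →ₗ[ℝ] E) ∘ₗ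
      (LinearMap.toContinuousLinearMap : (E →ₗ[ℝ] ℝ) ≃ₗ[ℝ] (E →L[ℝ] ℝ)).toLinearMap ∘ₗ
      ricci g p)

end Riemannian

/-! ### The supergravity r-map -/

section RMapConstruction

variable {m : ℕ}

/-- The cone `U = ℝ_{>0} · H` over a hypersurface `H ⊆ ℝ^m`. -/
def cone (H : Set (Fin m → ℝ)) : Set (Fin m → ℝ) :=
  {x | ∃ r : ℝ, 0 < r ∧ ∃ p ∈ H, x = r • p}

/-- The tube domain `M = ℝ^m + i U ⊆ ℂ^m` over the cone `U = ℝ_{>0} · H`. -/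
def tube (H : Set (Fin m → ℝ)) : Set (Fin m → ℂ) :=
  {z | (fun μ => (z μ).im) ∈ cone H}

/-- The coefficients `g_{μ \bar ν} = ∂² K / ∂z^μ ∂\bar z^ν` of the metric with Kähler potential
`K(z) = - log h(x)`, as functions of `x = Im z`:
`g_{μ \bar ν} = - h_{μν} / (4 h) + h_μ h_ν / (4 h²)`. -/
def kahlerCoeff (h : MvPolynomial (Fin m) ℝ) (x : Fin m → ℝ) (μ ν : Fin m) : ℝ :=
  -(MvPolynomial.eval x (MvPolynomial.pderiv μ (MvPolynomial.pderiv ν h)))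
      / (4 * MvPolynomial.eval x h)
    + MvPolynomial.eval x (MvPolynomial.pderiv μ h) * MvPolynomial.eval x (MvPolynomial.pderiv ν h)
      / (4 * MvPolynomial.eval x h ^ 2)

/-- The real covector `d(Re z^μ)` on `ℂ^m`. -/
def dRe (μ : Fin m) : (Fin m → ℂ) →L[ℝ] ℝ :=
  Complex.reCLM.comp (ContinuousLinearMap.proj μ)

/-- The real covector `d(Im z^μ)` on `ℂ^m`. -/
def dIm (μ : Fin m) : (Fin m → ℂ) →L[ℝ] ℝ :=
  Complex.imCLM.comp (ContinuousLinearMap.proj μ)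

/-- The metric `g_M = 2 g_{μ \bar ν} dz^μ d\bar z^ν` as a real bilinear form on `ℂ^m`. With
`z^μ = y^μ + i x^μ` and `g_{μ \bar ν}` real and symmetric it is
`2 g_{μ \bar ν} (dy^μ ⊗ dy^ν + dx^μ ⊗ dx^ν)`, evaluated at `x = Im z`. -/
def rMetric (h : MvPolynomial (Fin m) ℝ) (z : Fin m → ℂ) :
    (Fin m → ℂ) →L[ℝ] (Fin m → ℂ) →L[ℝ] ℝ :=
  ∑ μ, ∑ ν, (2 * kahlerCoeff h (fun κ => (z κ).im) μ ν) •
    ((dRe μ).smulRight (dRe ν) + (dIm μ).smulRight (dIm ν))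

end RMapConstruction

/-! ### The five surfaces -/

/-- Labels of the five surfaces. -/
inductive Label
  | a
  | b
  | c
  | d
  | e

open MvPolynomial in
/-- The cubic polynomials in the variables `x = X 0`, `y = X 1`, `z = X 2`. -/
def cubic : Label → MvPolynomial (Fin 3) ℝ
  | Label.a => X 0 * X 1 * X 2
  | Label.b => X 0 * (X 0 * X 1 - X 2 ^ 2)
  | Label.c => X 0 * (X 1 * X 2 + X 0 ^ 2)
  | Label.d => X 2 * (X 0 ^ 2 + X 1 ^ 2 - X 2 ^ 2)
  | Label.e => X 0 * (X 1 ^ 2 - X 2 ^ 2) + X 1 ^ 3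

/-- The open conditions that select a component of the level set `h = 1`. -/
def region : Label → Set (Fin 3 → ℝ)
  | Label.a => {p | 0 < p 0 ∧ 0 < p 1}
  | Label.b => {p | 0 < p 0}
  | Label.c => {p | p 0 < 0 ∧ 0 < p 1}
  | Label.d => {p | p 2 < 0}
  | Label.e => {p | p 1 < 0 ∧ 0 < p 0}

/-- The projective special real surface `H = {p ∈ region | h(p) = 1}`. -/
def surface (s : Label) : Set (Fin 3 → ℝ) :=
  {p | MvPolynomial.eval p (cubic s) = 1 ∧ p ∈ region s}

/-- The underlying domain in `ℂ^3` of the image of the surface under the r-map. -/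
def manifold (s : Label) : Set (Fin 3 → ℂ) := tube (surface s)

/-- The metric of the image of the surface under the r-map. -/
def metric (s : Label) : (Fin 3 → ℂ) → (Fin 3 → ℂ) →L[ℝ] (Fin 3 → ℂ) →L[ℝ] ℝ :=
  rMetric (cubic s)

/-- The image of the scalar curvature function of the manifold with label `s`. -/
def scalImage (s : Label) : Set ℝ := scal (metric s) '' manifold s

end RMap

end

noncomputable section
namespace RMap

/-! ### Invariance of the scalar curvature under isometries -/

section Naturality

set_option linter.unusedSectionVars false

variable {E : Type*} [NormedAddCommGroup E] [NormedSpace ℝ E] [FiniteDimensional ℝ E]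
  {M : Set E} {g : E → E →L[ℝ] E →L[ℝ] ℝ}

/-! Isometric manifolds have the same set of scalar curvature values, so non-isometry reduces to
computing these sets and separating them. Invariance (`Isometric.image_scal_eq`) is proved in
coordinates: differentiating φ^*g' = g gives the transformation law of the Christoffel symbols. A
second differentiation, antisymmetrised, makes the curvature tensor natural, and traces do the rest.

For the computation, let H = -½ ∂² log h be the coefficient matrix of the metric, N its inverse, and
D the determinant of the Hessian matrix of h. Because H depends on Im z only and is itself a
Hessian, the Christoffel symbols are complex bilinear, and `IsHessianField.scal_tubeMetric` gives
scal = -N^{bc} ∂_b Γ^a_{ac}, where Γ^a_{ac} = ½ N^{ab} ∂_b H_{ac}. This trace is ½ ∂_c log det H.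
Since h is a homogeneous cubic in three variables, Euler's identity and a rank-one update give N =
-2h (∂²h)⁻¹ + x xᵀ, and the trace becomes ½ ∂_c log(D h⁻³) (`trace_logThird`). Hence scal = -½
N^{bc} ∂_b ∂_c log(D h⁻³). The factor h⁻³ contributes -9, the term x xᵀ applied to log D contributes
3/2, and what remains is `IsHyperbolicOn.scal_rMetric`: scal = -15/2 + h · adj(∂²h)^{bc} (D D_{bc} -
D_b D_c) / D³.

The cone over each surface is {h > 0} intersected with the sign conditions, and the metric is
positive definite there by Sylvester's criterion. The correction term is constant for a) and b). For
c) and d) it is 3/2 times one cubic polynomial `profile` of a parameter ranging over (0, 1) and (1,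
4/3] respectively. For e) a curve of points already produces [-8, -6). Testing membership of -6, -7
and -8 tells the five images apart. -/

theorem two_le_smoothness : minSmoothness ℝ 2 ≤ (∞ : WithTop ℕ∞) :=
  minSmoothness_of_isRCLikeNormedField.trans_le
    (WithTop.coe_le_coe.2 (le_top : (2 : ℕ∞) ≤ ⊤))

theorem isInvertible_of_pos {b : E →L[ℝ] E →L[ℝ] ℝ} (hb : ∀ v, v ≠ 0 → 0 < b v v) :
    b.IsInvertible := by
  have hinj : Function.Injective (b : E →ₗ[ℝ] E →L[ℝ] ℝ) := by
    rw [injective_iff_map_eq_zero]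
    intro v hv
    by_contra hne
    have h0 := hb v hne
    have : b v = 0 := hv
    simp [this] at h0
  have hdim : Module.finrank ℝ E = Module.finrank ℝ (E →L[ℝ] ℝ) := by
    rw [← (LinearMap.toContinuousLinearMap : (E →ₗ[ℝ] ℝ) ≃ₗ[ℝ] (E →L[ℝ] ℝ)).finrank_eq]
    exact (Subspace.dual_finrank_eq).symm
  exact ⟨(LinearMap.linearEquivOfInjective _ hinj hdim).toContinuousLinearEquiv, by ext v w; rfl⟩

theorem eq_of_pairing {b : E →L[ℝ] E →L[ℝ] ℝ} (hb : ∀ v, v ≠ 0 → 0 < b v v) {v w : E}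
    (h : ∀ u, b v u = b w u) : v = w :=
  (isInvertible_of_pos hb).injective (ContinuousLinearMap.ext h)

theorem IsRiemannian.isInvertible (hg : IsRiemannian M g) {p : E} (hp : p ∈ M) :
    (g p).IsInvertible := isInvertible_of_pos (hg.pos p hp)

theorem IsRiemannian.contDiffAt (hg : IsRiemannian M g) {p : E} (hp : p ∈ M) :
    ContDiffAt ℝ ∞ g p := hg.contDiffOn.contDiffAt (hg.isOpen.mem_nhds hp)

theorem IsRiemannian.differentiableAt (hg : IsRiemannian M g) {p : E} (hp : p ∈ M) :
    DifferentiableAt ℝ g p := (hg.contDiffAt hp).differentiableAt (by simp)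

theorem IsRiemannian.contDiffAt_christoffelLower (hg : IsRiemannian M g) {p : E} (hp : p ∈ M) :
    ContDiffAt ℝ ∞ (christoffelLower g) p := by
  have h1 : ContDiffAt ℝ ∞ (fderiv ℝ g) p := (hg.contDiffAt hp).fderiv_right (by simp)
  have h2 : ContDiffAt ℝ ∞ (fun q => (fderiv ℝ g q).flip) p :=
    (ContinuousLinearMap.flipₗᵢ ℝ E E (E →L[ℝ] ℝ)).contDiff.contDiffAt.comp p h1
  unfold christoffelLower
  exact ((h1.add h2).sub (contDiffAt_const.clm_comp h2)).const_smul _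

theorem IsRiemannian.contDiffAt_christoffel (hg : IsRiemannian M g) {p : E} (hp : p ∈ M) :
    ContDiffAt ℝ ∞ (christoffel g) p := by
  have h1 : ContDiffAt ℝ ∞ (fun q => (g q).inverse) p :=
    ((hg.isInvertible hp).contDiffAt_map_inverse).comp p (hg.contDiffAt hp)
  unfold christoffel
  exact (contDiffAt_const.clm_apply h1).clm_comp (hg.contDiffAt_christoffelLower hp)

theorem IsRiemannian.differentiableAt_christoffel (hg : IsRiemannian M g) {p : E} (hp : p ∈ M) :
    DifferentiableAt ℝ (christoffel g) p := (hg.contDiffAt_christoffel hp).differentiableAt (by simp)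

theorem IsRiemannian.apply_christoffel (hg : IsRiemannian M g) {p : E} (hp : p ∈ M) (v w u : E) :
    g p (christoffel g p v w) u = christoffelLower g p v w u := by
  rw [christoffel_apply, (hg.isInvertible hp).self_apply_inverse]

theorem fderiv_apply₂ {F G : Type*} [NormedAddCommGroup F] [NormedSpace ℝ F]
    [NormedAddCommGroup G] [NormedSpace ℝ G] {c : E → F →L[ℝ] F →L[ℝ] G} {p : E}
    (hc : DifferentiableAt ℝ c p) {a b : E → F} (ha : DifferentiableAt ℝ a p)
    (hb : DifferentiableAt ℝ b p) (u : E) :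
    fderiv ℝ (fun q => c q (a q) (b q)) p u =
      fderiv ℝ c p u (a p) (b p) + c p (fderiv ℝ a p u) (b p) + c p (a p) (fderiv ℝ b p u) := by
  rw [((hc.hasFDerivAt.clm_apply ha.hasFDerivAt).clm_apply hb.hasFDerivAt).fderiv]
  simp
  abel

theorem differentiableAt_apply₂ {F G : Type*} [NormedAddCommGroup F] [NormedSpace ℝ F]
    [NormedAddCommGroup G] [NormedSpace ℝ G] {c : E → F →L[ℝ] F →L[ℝ] G} {p : E}
    (hc : DifferentiableAt ℝ c p) {a b : E → F} (ha : DifferentiableAt ℝ a p)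
    (hb : DifferentiableAt ℝ b p) : DifferentiableAt ℝ (fun q => c q (a q) (b q)) p :=
  (hc.clm_apply ha).clm_apply hb

variable {E' : Type*} [NormedAddCommGroup E'] [NormedSpace ℝ E'] [FiniteDimensional ℝ E']
  {M' : Set E'} {g' : E' → E' →L[ℝ] E' →L[ℝ] ℝ}

/-- `φ : M → M'` is a smooth local isometry of Riemannian manifolds. -/
structure IsLocalIsometry (M : Set E) (g : E → E →L[ℝ] E →L[ℝ] ℝ) (M' : Set E')
    (g' : E' → E' →L[ℝ] E' →L[ℝ] ℝ) (φ : E → E') : Prop where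
  source : IsRiemannian M g
  target : IsRiemannian M' g'
  mapsTo : Set.MapsTo φ M M'
  contDiffOn : ContDiffOn ℝ ∞ φ M
  surjective : ∀ p ∈ M, Function.Surjective (fderiv ℝ φ p)
  pullback : ∀ p ∈ M, ∀ v w, g' (φ p) (fderiv ℝ φ p v) (fderiv ℝ φ p w) = g p v w

namespace IsLocalIsometry

variable {φ : E → E'} (h : IsLocalIsometry M g M' g' φ) {p : E} (hp : p ∈ M)
include h hp

theorem contDiffAt : ContDiffAt ℝ ∞ φ p :=
  h.contDiffOn.contDiffAt (h.source.isOpen.mem_nhds hp)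

theorem contDiffAt_fderiv : ContDiffAt ℝ ∞ (fderiv ℝ φ) p :=
  (h.contDiffAt hp).fderiv_right (by simp)

theorem differentiableAt : DifferentiableAt ℝ φ p := (h.contDiffAt hp).differentiableAt (by simp)

theorem differentiableAt_fderiv : DifferentiableAt ℝ (fderiv ℝ φ) p :=
  (h.contDiffAt_fderiv hp).differentiableAt (by simp)

theorem differentiableAt_fderiv_fderiv : DifferentiableAt ℝ (fderiv ℝ (fderiv ℝ φ)) p :=
  ((h.contDiffAt_fderiv hp).fderiv_right (m := ∞) (by simp)).differentiableAt (by simp)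

theorem snd_symm (u v : E) :
    fderiv ℝ (fderiv ℝ φ) p u v = fderiv ℝ (fderiv ℝ φ) p v u :=
  (h.contDiffAt hp).isSymmSndFDerivAt two_le_smoothness u v

theorem third_symm (u v w : E) :
    fderiv ℝ (fderiv ℝ (fderiv ℝ φ)) p u v w = fderiv ℝ (fderiv ℝ (fderiv ℝ φ)) p v u w := by
  rw [(h.contDiffAt_fderiv hp).isSymmSndFDerivAt two_le_smoothness u v]

/-- The product and chain rules applied to φ^*g' = g, which holds on a neighbourhood of `p` because
M is open. -/
theorem fderiv_metric (u v w : E) :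
    fderiv ℝ g p u v w = fderiv ℝ g' (φ p) (fderiv ℝ φ p u) (fderiv ℝ φ p v) (fderiv ℝ φ p w)
      + g' (φ p) (fderiv ℝ (fderiv ℝ φ) p u v) (fderiv ℝ φ p w)
      + g' (φ p) (fderiv ℝ φ p v) (fderiv ℝ (fderiv ℝ φ) p u w) := by
  have hev : (fun q => g q v w) =ᶠ[nhds p]
      fun q => g' (φ q) (fderiv ℝ φ q v) (fderiv ℝ φ q w) := by
    filter_upwards [h.source.isOpen.mem_nhds hp] with q hq
    rw [h.pullback q hq]
  have hd (v : E) : DifferentiableAt ℝ (fun q => fderiv ℝ φ q v) p :=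
    (h.differentiableAt_fderiv hp).clm_apply (differentiableAt_const _)
  have hd' (v : E) : fderiv ℝ (fun q => fderiv ℝ φ q v) p u = fderiv ℝ (fderiv ℝ φ) p u v := by
    rw [fderiv_clm_apply (h.differentiableAt_fderiv hp) (differentiableAt_const _)]
    simp
  have hg' := h.target.differentiableAt (h.mapsTo hp)
  have h1 := fderiv_apply₂ (h.source.differentiableAt hp) (differentiableAt_const v)
    (differentiableAt_const w) u
  have h2 := fderiv_apply₂ (hg'.comp p (h.differentiableAt hp)) (hd v) (hd w) u
  simp only [Function.comp_apply] at h2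
  rw [hev.fderiv_eq, h2, hd', hd', fderiv_comp p hg' (h.differentiableAt hp)] at h1
  simpa using h1.symm

/-- Since dφ is onto and g' is nondegenerate, it suffices to pair both sides with dφ(u). The three
derivatives of g then contribute second derivatives of φ, which cancel in pairs by symmetry except
for one that appears twice; the factor ½ leaves g'(D²φ(v, w), dφ u). -/
theorem fderiv_christoffel_apply (v w : E) :
    fderiv ℝ φ p (christoffel g p v w) =
      christoffel g' (φ p) (fderiv ℝ φ p v) (fderiv ℝ φ p w) + fderiv ℝ (fderiv ℝ φ) p v w := by
  apply eq_of_pairing (h.target.pos _ (h.mapsTo hp))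
  intro u'
  obtain ⟨u, rfl⟩ := h.surjective p hp u'
  rw [h.pullback p hp, h.source.apply_christoffel hp, map_add, add_apply,
    h.target.apply_christoffel (h.mapsTo hp), christoffelLower_apply, christoffelLower_apply,
    h.fderiv_metric hp, h.fderiv_metric hp, h.fderiv_metric hp, h.snd_symm hp w v,
    h.snd_symm hp u v, h.snd_symm hp u w,
    h.target.symm _ (h.mapsTo hp) (fderiv ℝ φ p w) (fderiv ℝ (fderiv ℝ φ) p v u),
    h.target.symm _ (h.mapsTo hp) (fderiv ℝ φ p v) (fderiv ℝ (fderiv ℝ φ) p w u)]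
  ring

/-- The derivative of the transformation law `fderiv_christoffel_apply` in the direction `u`, valid
because that law holds near `p`. -/
theorem fderiv_christoffel_law (u v w : E) :
    fderiv ℝ φ p (fderiv ℝ (christoffel g) p u v w)
        + fderiv ℝ (fderiv ℝ φ) p u (christoffel g p v w) =
      fderiv ℝ (christoffel g') (φ p) (fderiv ℝ φ p u) (fderiv ℝ φ p v) (fderiv ℝ φ p w)
      + christoffel g' (φ p) (fderiv ℝ (fderiv ℝ φ) p u v) (fderiv ℝ φ p w)
      + christoffel g' (φ p) (fderiv ℝ φ p v) (fderiv ℝ (fderiv ℝ φ) p u w)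
      + fderiv ℝ (fderiv ℝ (fderiv ℝ φ)) p u v w := by
  have hev : (fun q => fderiv ℝ φ q (christoffel g q v w)) =ᶠ[nhds p]
      fun q => christoffel g' (φ q) (fderiv ℝ φ q v) (fderiv ℝ φ q w)
        + fderiv ℝ (fderiv ℝ φ) q v w := by
    filter_upwards [h.source.isOpen.mem_nhds hp] with q hq
    rw [h.fderiv_christoffel_apply hq]
  have hd (v : E) : DifferentiableAt ℝ (fun q => fderiv ℝ φ q v) p :=
    (h.differentiableAt_fderiv hp).clm_apply (differentiableAt_const _)
  have hd' (v : E) : fderiv ℝ (fun q => fderiv ℝ φ q v) p u = fderiv ℝ (fderiv ℝ φ) p u v := by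
    rw [fderiv_clm_apply (h.differentiableAt_fderiv hp) (differentiableAt_const _)]
    simp
  have hc := h.source.differentiableAt_christoffel hp
  have hc' := h.target.differentiableAt_christoffel (h.mapsTo hp)
  have hcφ : DifferentiableAt ℝ (fun q => christoffel g' (φ q)) p :=
    hc'.comp p (h.differentiableAt hp)
  have h0 := fderiv_apply₂ hc (differentiableAt_const v) (differentiableAt_const w) u
  have h1 := fderiv_apply₂ hcφ (hd v) (hd w) u
  have h2 := fderiv_apply₂ (h.differentiableAt_fderiv_fderiv hp) (differentiableAt_const v)
    (differentiableAt_const w) u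
  have h3 : DifferentiableAt ℝ (fun q => christoffel g q v w) p :=
    differentiableAt_apply₂ hc (differentiableAt_const v) (differentiableAt_const w)
  have h4 := hev.fderiv_eq (𝕜 := ℝ)
  rw [fderiv_clm_apply (h.differentiableAt_fderiv hp) h3, fderiv_fun_add
    (differentiableAt_apply₂ hcφ (hd v) (hd w))
    (differentiableAt_apply₂ (h.differentiableAt_fderiv_fderiv hp) (differentiableAt_const v)
    (differentiableAt_const w))] at h4
  have h5 := congrArg (fun L => L u) h4
  simp only [add_apply] at h5
  rw [h1, h2, hd', hd', fderiv_fun_comp p hc' (h.differentiableAt hp)] at h5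
  simpa [h0] using h5

/-- Antisymmetrise `fderiv_christoffel_law` in `u` and `v`: D³φ drops out by symmetry of mixed
derivatives. The remaining terms in D²φ cancel against those in the transformation law for Γ(u, Γ(v,
w)) and Γ(v, Γ(u, w)). -/
theorem fderiv_riemann (u v w : E) :
    fderiv ℝ φ p (riemann g p u v w) =
      riemann g' (φ p) (fderiv ℝ φ p u) (fderiv ℝ φ p v) (fderiv ℝ φ p w) := by
  have h1 := h.fderiv_christoffel_law hp u v w
  have h2 := h.fderiv_christoffel_law hp v u w
  have h3 := h.fderiv_christoffel_apply hp u (christoffel g p v w)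
  have h4 := h.fderiv_christoffel_apply hp v (christoffel g p u w)
  rw [h.fderiv_christoffel_apply hp v w, map_add] at h3
  rw [h.fderiv_christoffel_apply hp u w, map_add] at h4
  rw [h.third_symm hp v u w, h.snd_symm hp v u] at h2
  simp only [riemann, add_apply, sub_apply, ContinuousLinearMap.comp_apply, map_add, map_sub]
  rw [eq_sub_of_add_eq h1, eq_sub_of_add_eq h2, h3, h4]
  abel

theorem injective : Function.Injective (fderiv ℝ φ p) := by
  rw [injective_iff_map_eq_zero]
  intro v hv
  by_contra hne
  have h0 := h.source.pos p hp v hne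
  rw [← h.pullback p hp, hv] at h0
  simp at h0

theorem ricci_eq (v w : E) :
    ricci g p v w = ricci g' (φ p) (fderiv ℝ φ p v) (fderiv ℝ φ p w) := by
  let e : E ≃ₗ[ℝ] E' := LinearEquiv.ofBijective (fderiv ℝ φ p : E →ₗ[ℝ] E')
    ⟨h.injective hp, h.surjective p hp⟩
  have he (x : E) : e x = fderiv ℝ φ p x := rfl
  change LinearMap.trace ℝ E (riemannEnd g p v w) = LinearMap.trace ℝ E' (riemannEnd g' (φ p) _ _)
  rw [← LinearMap.trace_conj' _ e]
  congr 1
  ext x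
  obtain ⟨u, rfl⟩ := e.surjective x
  rw [LinearEquiv.conj_apply]
  simp only [LinearMap.comp_apply, LinearEquiv.coe_coe, LinearEquiv.symm_apply_apply]
  rw [he, he]
  exact h.fderiv_riemann hp u v w

theorem scal_eq : scal g p = scal g' (φ p) := by
  let e : E ≃ₗ[ℝ] E' := LinearEquiv.ofBijective (fderiv ℝ φ p : E →ₗ[ℝ] E')
    ⟨h.injective hp, h.surjective p hp⟩
  have he (x : E) : e x = fderiv ℝ φ p x := rfl
  unfold scal
  congr 1
  rw [← LinearMap.trace_conj' _ e]
  congr 1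
  ext x
  obtain ⟨v, rfl⟩ := e.surjective x
  rw [LinearEquiv.conj_apply]
  simp only [LinearMap.comp_apply, LinearEquiv.coe_coe, LinearEquiv.symm_apply_apply]
  apply eq_of_pairing (h.target.pos _ (h.mapsTo hp))
  intro u'
  obtain ⟨u, rfl⟩ := h.surjective p hp u'
  rw [he, he, h.pullback p hp]
  simp only [ContinuousLinearMap.coe_coe]
  rw [(h.source.isInvertible hp).self_apply_inverse,
    (h.target.isInvertible (h.mapsTo hp)).self_apply_inverse]
  exact h.ricci_eq hp v u

end IsLocalIsometry

theorem Isometric.image_scal_eq (hg : IsRiemannian M g) (hg' : IsRiemannian M' g')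
    (h : Isometric M g M' g') : scal g '' M = scal g' '' M' := by
  obtain ⟨φ, ψ, hφ, hψ, hl, hr, hφd, hψd, hpull⟩ := h
  have hloc : IsLocalIsometry M g M' g' φ := by
    -- Differentiating φ ∘ ψ = id at φ(p) shows that dψ is a right inverse of dφ, hence the preimage
    -- of `w`.
    refine ⟨hg, hg', hφ, hφd, fun p hp w => ⟨fderiv ℝ ψ (φ p) w, ?_⟩, hpull⟩
    have h1 : DifferentiableAt ℝ φ (ψ (φ p)) := by
      rw [hl hp]
      exact (hφd.contDiffAt (hg.isOpen.mem_nhds hp)).differentiableAt (by simp)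
    have h2 : DifferentiableAt ℝ ψ (φ p) :=
      (hψd.contDiffAt (hg'.isOpen.mem_nhds (hφ hp))).differentiableAt (by simp)
    have h3 : φ ∘ ψ =ᶠ[nhds (φ p)] id := by
      filter_upwards [hg'.isOpen.mem_nhds (hφ hp)] with q hq using hr hq
    have h4 := h3.fderiv_eq (𝕜 := ℝ)
    rw [fderiv_comp _ h1 h2, hl hp, fderiv_id] at h4
    exact congrArg (fun L => L w) h4
  ext c
  constructor
  · rintro ⟨p, hp, rfl⟩
    exact ⟨φ p, hφ hp, (hloc.scal_eq hp).symm⟩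
  · rintro ⟨q, hq, rfl⟩
    exact ⟨ψ q, hψ hq, by rw [hloc.scal_eq (hψ hq), hr hq]⟩

end Naturality

/-! ### Curvature of a Hessian metric on a tube domain -/

section Tube

variable {m : ℕ}

/-- The imaginary part `ℂ^m → ℝ^m`. -/
def imPart : (Fin m → ℂ) →L[ℝ] (Fin m → ℝ) := ContinuousLinearMap.pi dIm

@[simp] theorem imPart_apply (z : Fin m → ℂ) (μ : Fin m) : imPart z μ = (z μ).im := rfl

/-- The metric `∑ H_{μν}(Im z) (dy^μ ⊗ dy^ν + dx^μ ⊗ dx^ν)` on `ℂ^m`, `z = y + i x`. -/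
def tubeMetric (H : (Fin m → ℝ) → Matrix (Fin m) (Fin m) ℝ) (z : Fin m → ℂ) :
    (Fin m → ℂ) →L[ℝ] (Fin m → ℂ) →L[ℝ] ℝ :=
  ∑ μ, ∑ ν, H (imPart z) μ ν • ((dRe μ).smulRight (dRe ν) + (dIm μ).smulRight (dIm ν))

theorem tubeMetric_apply (H : (Fin m → ℝ) → Matrix (Fin m) (Fin m) ℝ) (z v w : Fin m → ℂ) :
    tubeMetric H z v w =
      ∑ μ, ∑ ν, H (imPart z) μ ν * ((v μ).re * (w ν).re + (v μ).im * (w ν).im) := by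
  simp [tubeMetric, dRe, dIm, mul_add]

/-- `H` is a smooth field of symmetric invertible matrices on the open set `U` with inverse `N`
and partial derivatives `∂_κ H_{μν} = T_{κμν}` that are totally symmetric, as is the case for the
Hessian of a function. -/
structure IsHessianField (U : Set (Fin m → ℝ)) (H N : (Fin m → ℝ) → Matrix (Fin m) (Fin m) ℝ)
    (T : (Fin m → ℝ) → Fin m → Fin m → Fin m → ℝ) : Prop where
  isOpen : IsOpen U
  symm : ∀ x ∈ U, ∀ μ ν, H x μ ν = H x ν μ
  mul_eq_one : ∀ x ∈ U, N x * H x = 1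
  hasFDerivAt : ∀ x ∈ U, ∀ μ ν, HasFDerivAt (fun y => H y μ ν)
    (∑ κ, T x κ μ ν • (ContinuousLinearMap.proj κ : (Fin m → ℝ) →L[ℝ] ℝ)) x
  symm_left : ∀ x ∈ U, ∀ κ μ ν, T x κ μ ν = T x μ κ ν
  symm_right : ∀ x ∈ U, ∀ κ μ ν, T x κ μ ν = T x κ ν μ
  differentiableAt_inv : ∀ x ∈ U, ∀ μ ν, DifferentiableAt ℝ (fun y => N y μ ν) x
  differentiableAt_third : ∀ x ∈ U, ∀ κ μ ν, DifferentiableAt ℝ (fun y => T y κ μ ν) x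
  isRiemannian : IsRiemannian (imPart ⁻¹' U) (tubeMetric H)

/-- The Christoffel symbols `½ N^{κλ} ∂_λ H_{μν}` of a Hessian metric. -/
def hessianChristoffel (N : (Fin m → ℝ) → Matrix (Fin m) (Fin m) ℝ)
    (T : (Fin m → ℝ) → Fin m → Fin m → Fin m → ℝ) (κ μ ν : Fin m) (x : Fin m → ℝ) : ℝ :=
  (1 / 2) * ∑ l, N x κ l * T x l μ ν

/-- The trilinear form with coefficients `T`. -/
def trilinear (T : Fin m → Fin m → Fin m → ℝ) (a b c : Fin m → ℝ) : ℝ :=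
  ∑ κ, ∑ μ, ∑ ν, T κ μ ν * (a κ * b μ * c ν)

theorem trilinear_swap_left {T : Fin m → Fin m → Fin m → ℝ}
    (hT : ∀ κ μ ν, T κ μ ν = T μ κ ν) (a b c : Fin m → ℝ) :
    trilinear T a b c = trilinear T b a c := by
  unfold trilinear
  rw [Finset.sum_comm]
  refine Finset.sum_congr rfl fun μ _ => Finset.sum_congr rfl fun κ _ =>
    Finset.sum_congr rfl fun ν _ => ?_
  rw [hT]; ring

theorem trilinear_swap_right {T : Fin m → Fin m → Fin m → ℝ}
    (hT : ∀ κ μ ν, T κ μ ν = T κ ν μ) (a b c : Fin m → ℝ) :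
    trilinear T a b c = trilinear T a c b := by
  unfold trilinear
  refine Finset.sum_congr rfl fun κ _ => ?_
  rw [Finset.sum_comm]
  refine Finset.sum_congr rfl fun μ _ => Finset.sum_congr rfl fun ν _ => ?_
  rw [hT]; ring

theorem trace_complex_pi (L : (Fin m → ℂ) →ₗ[ℝ] (Fin m → ℂ)) :
    LinearMap.trace ℝ (Fin m → ℂ) L =
      ∑ a, ((L (Pi.single a 1) a).re + (L (Pi.single a Complex.I) a).im) := by
  rw [LinearMap.trace_eq_matrix_trace ℝ (Pi.basis fun _ : Fin m => Complex.basisOneI)]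
  simp [Matrix.trace, Fintype.sum_sigma, LinearMap.toMatrix_apply]

namespace IsHessianField

variable {U : Set (Fin m → ℝ)} {H N : (Fin m → ℝ) → Matrix (Fin m) (Fin m) ℝ}
  {T : (Fin m → ℝ) → Fin m → Fin m → Fin m → ℝ} (h : IsHessianField U H N T)
include h

theorem fderiv_tubeMetric {z : Fin m → ℂ} (hz : imPart z ∈ U) (u v w : Fin m → ℂ) :
    fderiv ℝ (tubeMetric H) z u v w =
      trilinear (T (imPart z)) (imPart u) (fun μ => (v μ).re) (fun μ => (w μ).re)
      + trilinear (T (imPart z)) (imPart u) (imPart v) (imPart w) := by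
  have h1 := fderiv_apply₂ (h.isRiemannian.differentiableAt (p := z) hz)
    (differentiableAt_const v) (differentiableAt_const w) u
  have h2 : HasFDerivAt (fun q => tubeMetric H q v w)
      (∑ μ, ∑ ν, ((v μ).re * (w ν).re + (v μ).im * (w ν).im) •
        ((∑ κ, T (imPart z) κ μ ν • (ContinuousLinearMap.proj κ : (Fin m → ℝ) →L[ℝ] ℝ)).comp
          imPart)) z := by
    simp only [tubeMetric_apply]
    refine HasFDerivAt.fun_sum fun μ _ => HasFDerivAt.fun_sum fun ν _ => ?_
    exact ((h.hasFDerivAt _ hz μ ν).comp z imPart.hasFDerivAt).mul_const _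
  rw [h2.fderiv] at h1
  rw [fderiv_fun_const, fderiv_fun_const] at h1
  simp only [Pi.zero_apply, zero_apply, map_zero, add_zero] at h1
  rw [← h1]
  unfold trilinear
  rw [← Finset.sum_add_distrib]
  simp only [← Finset.sum_add_distrib, sum_apply, smul_apply,
    ContinuousLinearMap.comp_apply, Finset.mul_sum, smul_eq_mul, ContinuousLinearMap.proj_apply]
  rw [Finset.sum_congr rfl fun μ _ => Finset.sum_comm, Finset.sum_comm]
  refine Finset.sum_congr rfl fun κ _ => Finset.sum_congr rfl fun μ _ =>
    Finset.sum_congr rfl fun ν _ => ?_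
  simp only [imPart_apply]
  ring

theorem mul_eq_one' {x : Fin m → ℝ} (hx : x ∈ U) : H x * N x = 1 :=
  mul_eq_one_comm.1 (h.mul_eq_one x hx)

/-- The claimed vector is checked by lowering its index, using nondegeneracy. Total symmetry of `T`
identifies the three terms of the Koszul formula, which combine into the real pairing with -(i/2)
T(v, w), where T is extended complex bilinearly. -/
theorem christoffel_tubeMetric {z : Fin m → ℂ} (hz : imPart z ∈ U) (v w : Fin m → ℂ) :
    christoffel (tubeMetric H) z v w = fun κ => -Complex.I *
      ∑ μ, ∑ ν, (hessianChristoffel N T κ μ ν (imPart z) : ℂ) * (v μ * w ν) := by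
  set x := imPart z with hx
  set c : Fin m → ℂ := fun l => ∑ μ, ∑ ν, (T x l μ ν : ℂ) * (v μ * w ν) with hc
  set X : Fin m → ℂ := fun κ => -Complex.I *
      ∑ μ, ∑ ν, (hessianChristoffel N T κ μ ν x : ℂ) * (v μ * w ν) with hX
  have hXc (κ : Fin m) : X κ = -Complex.I / 2 * ∑ l, (N x κ l : ℂ) * c l := by
    simp only [hX, hc, hessianChristoffel]
    push_cast
    simp only [Finset.mul_sum, Finset.sum_mul]
    rw [Finset.sum_congr rfl fun μ _ => Finset.sum_comm, Finset.sum_comm]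
    refine Finset.sum_congr rfl fun κ _ => Finset.sum_congr rfl fun μ _ =>
      Finset.sum_congr rfl fun ν _ => ?_
    ring
  have hHX (ν : Fin m) : ∑ κ, (H x κ ν : ℂ) * X κ = -Complex.I / 2 * c ν := by
    simp only [hXc, Finset.mul_sum]
    rw [Finset.sum_comm]
    have (l : Fin m) : ∑ κ, (H x κ ν : ℂ) * (-Complex.I / 2 * ((N x κ l : ℂ) * c l)) =
        ((H x * N x) ν l : ℂ) * (-Complex.I / 2 * c l) := by
      rw [Matrix.mul_apply]
      push_cast
      rw [Finset.sum_mul]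
      refine Finset.sum_congr rfl fun κ _ => ?_
      rw [h.symm x hz κ ν]; ring
    rw [Finset.sum_congr rfl fun l _ => this l, h.mul_eq_one' hz, Finset.sum_eq_single ν]
    · simp
    · intro l _ hl
      simp [Matrix.one_apply_ne hl.symm]
    · simp
  have hpair (u : Fin m → ℂ) : tubeMetric H z X u =
      ∑ ν, ((-Complex.I / 2 * c ν).re * (u ν).re + (-Complex.I / 2 * c ν).im * (u ν).im) := by
    rw [tubeMetric_apply, Finset.sum_comm]
    refine Finset.sum_congr rfl fun ν _ => ?_
    rw [← hHX, Complex.re_sum, Complex.im_sum, Finset.sum_mul, Finset.sum_mul,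
      ← Finset.sum_add_distrib]
    refine Finset.sum_congr rfl fun κ _ => ?_
    simp only [Complex.re_ofReal_mul, Complex.im_ofReal_mul, ← hx]
    ring
  apply eq_of_pairing (h.isRiemannian.pos z hz)
  intro u
  rw [h.isRiemannian.apply_christoffel hz, hpair, christoffelLower_apply, h.fderiv_tubeMetric hz,
    h.fderiv_tubeMetric hz, h.fderiv_tubeMetric hz, ← hx]
  have hl := trilinear_swap_left (h.symm_left x hz)
  have hr := trilinear_swap_right (h.symm_right x hz)
  set u₁ : Fin m → ℝ := fun μ => (u μ).re with hu₁
  set v₁ : Fin m → ℝ := fun μ => (v μ).re with hv₁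
  set w₁ : Fin m → ℝ := fun μ => (w μ).re with hw₁
  have hre : ∑ ν, (c ν).re * (u ν).im = trilinear (T x) (imPart u) v₁ w₁
      - trilinear (T x) (imPart u) (imPart v) (imPart w) := by
    simp only [hc, trilinear, Complex.re_sum, Finset.sum_mul, ← Finset.sum_sub_distrib,
      Complex.mul_re, Complex.ofReal_re, Complex.ofReal_im, hv₁, hw₁, imPart_apply]
    refine Finset.sum_congr rfl fun κ _ => Finset.sum_congr rfl fun μ _ =>
      Finset.sum_congr rfl fun ν _ => ?_
    ring
  have him : ∑ ν, (c ν).im * (u ν).re = trilinear (T x) u₁ v₁ (imPart w)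
      + trilinear (T x) u₁ (imPart v) w₁ := by
    simp only [hc, trilinear, Complex.im_sum, Finset.sum_mul, ← Finset.sum_add_distrib,
      Complex.mul_im, Complex.ofReal_re, Complex.ofReal_im, hv₁, hw₁, hu₁, imPart_apply]
    refine Finset.sum_congr rfl fun κ _ => Finset.sum_congr rfl fun μ _ =>
      Finset.sum_congr rfl fun ν _ => ?_
    ring
  have hsum : ∑ ν, ((-Complex.I / 2 * c ν).re * (u ν).re + (-Complex.I / 2 * c ν).im * (u ν).im)
      = 1 / 2 * (∑ ν, (c ν).im * (u ν).re - ∑ ν, (c ν).re * (u ν).im) := by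
    rw [← Finset.sum_sub_distrib, Finset.mul_sum]
    refine Finset.sum_congr rfl fun ν _ => ?_
    have : -Complex.I / 2 * c ν = ((1 / 2 : ℝ) : ℂ) * (-Complex.I * c ν) := by push_cast; ring
    rw [this, Complex.re_ofReal_mul, Complex.im_ofReal_mul]
    simp
    ring
  -- Total symmetry of `T` brings all trilinear terms to common argument orders.
  rw [hsum, hre, him, hl (imPart v) w₁ u₁, hr w₁ (imPart v) u₁, hl w₁ u₁ (imPart v),
    hr u₁ w₁ (imPart v), hl (imPart w) v₁ u₁, hr v₁ (imPart w) u₁, hl v₁ u₁ (imPart w),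
    hl (imPart v) (imPart w) (imPart u), hr (imPart w) (imPart v) (imPart u),
    hl (imPart w) (imPart u) (imPart v), hr (imPart u) (imPart w) (imPart v)]
  ring

theorem differentiableAt_hessianChristoffel {x : Fin m → ℝ} (hx : x ∈ U) (κ μ ν : Fin m) :
    DifferentiableAt ℝ (hessianChristoffel N T κ μ ν) x := by
  unfold hessianChristoffel
  exact (DifferentiableAt.fun_sum fun l _ => (h.differentiableAt_inv x hx κ l).mul
    (h.differentiableAt_third x hx l μ ν)).const_mul _

theorem fderiv_christoffel_tubeMetric {z : Fin m → ℂ} (hz : imPart z ∈ U) (u v w : Fin m → ℂ)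
    (κ : Fin m) :
    fderiv ℝ (christoffel (tubeMetric H)) z u v w κ = -Complex.I * ∑ μ, ∑ ν,
      (fderiv ℝ (hessianChristoffel N T κ μ ν) (imPart z) (imPart u) : ℂ) * (v μ * w ν) := by
  have hd := h.isRiemannian.differentiableAt_christoffel (p := z) hz
  have h1 := fderiv_apply₂ hd (differentiableAt_const v) (differentiableAt_const w) u
  have h2 : HasFDerivAt (fun q => christoffel (tubeMetric H) q v w κ)
      ((ContinuousLinearMap.proj κ : (Fin m → ℂ) →L[ℝ] ℂ).comp
        (fderiv ℝ (fun q => christoffel (tubeMetric H) q v w) z)) z :=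
    (ContinuousLinearMap.proj κ : (Fin m → ℂ) →L[ℝ] ℂ).hasFDerivAt.comp z
      (differentiableAt_apply₂ hd (differentiableAt_const v)
        (differentiableAt_const w)).hasFDerivAt
  have h3 : HasFDerivAt (fun q => -Complex.I *
      ∑ μ, ∑ ν, (hessianChristoffel N T κ μ ν (imPart q) : ℂ) * (v μ * w ν))
      (-Complex.I • ∑ μ, ∑ ν, (Complex.ofRealCLM.comp ((fderiv ℝ (hessianChristoffel N T κ μ ν)
        (imPart z)).comp imPart)).smulRight (v μ * w ν)) z := by
    refine HasFDerivAt.const_mul (HasFDerivAt.fun_sum fun μ _ => HasFDerivAt.fun_sum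
      fun ν _ => ?_) _
    have := (Complex.ofRealCLM.hasFDerivAt.comp z
      (((h.differentiableAt_hessianChristoffel hz κ μ ν).hasFDerivAt).comp z
        imPart.hasFDerivAt)).mul_const' (v μ * w ν)
    exact this
  have hev : (fun q => christoffel (tubeMetric H) q v w κ) =ᶠ[nhds z] fun q => -Complex.I *
      ∑ μ, ∑ ν, (hessianChristoffel N T κ μ ν (imPart q) : ℂ) * (v μ * w ν) := by
    filter_upwards [h.isRiemannian.isOpen.mem_nhds hz] with q hq
    rw [h.christoffel_tubeMetric hq]
  have h4 := congrArg (fun L => L u) (h2.unique (h3.congr_of_eventuallyEq hev))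
  simp only [ContinuousLinearMap.comp_apply, ContinuousLinearMap.proj_apply, h1, smul_apply,
    sum_apply, ContinuousLinearMap.smulRight_apply, smul_eq_mul,
    Complex.ofRealCLM_apply] at h4
  simpa using h4

/-- The symbols depend on Im z only, so a derivative in the direction α e_a sees just Im α. The sign
of the quadratic term comes from (-i)² = -1. -/
theorem riemann_single {z : Fin m → ℂ} (hz : imPart z ∈ U) (a b c κ : Fin m) (α β γ : ℂ) :
    riemann (tubeMetric H) z (Pi.single a α) (Pi.single b β) (Pi.single c γ) κ =
      -Complex.I * α.im * β * γ *
        (fderiv ℝ (hessianChristoffel N T κ b c) (imPart z) (Pi.single a 1) : ℝ)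
      + Complex.I * α * β.im * γ *
        (fderiv ℝ (hessianChristoffel N T κ a c) (imPart z) (Pi.single b 1) : ℝ)
      - α * β * γ * (∑ l, (hessianChristoffel N T κ a l (imPart z)
          * hessianChristoffel N T l b c (imPart z)
        - hessianChristoffel N T κ b l (imPart z)
          * hessianChristoffel N T l a c (imPart z)) : ℝ) := by
  have him (a : Fin m) (α : ℂ) : imPart (Pi.single a α : Fin m → ℂ) =
      α.im • (Pi.single a 1 : Fin m → ℝ) := by
    ext μ
    by_cases hμ : μ = a
    · subst hμ; simp
    · simp [hμ]
  have hsum (f : Fin m → Fin m → ℂ) (b c : Fin m) (β γ : ℂ) :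
      ∑ μ, ∑ ν, f μ ν * ((Pi.single b β : Fin m → ℂ) μ * (Pi.single c γ : Fin m → ℂ) ν) =
        f b c * (β * γ) := by
    simp [Pi.single_apply]
  have hsum' (f : Fin m → Fin m → ℂ) (b : Fin m) (β : ℂ) (w : Fin m → ℂ) :
      ∑ μ, ∑ ν, f μ ν * ((Pi.single b β : Fin m → ℂ) μ * w ν) =
        ∑ ν, f b ν * (β * w ν) := by
    simp [Pi.single_apply]
  simp only [riemann, add_apply, sub_apply, ContinuousLinearMap.comp_apply, Pi.add_apply,
    Pi.sub_apply, h.fderiv_christoffel_tubeMetric hz, h.christoffel_tubeMetric hz, him, hsum,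
    hsum', map_smul, smul_eq_mul]
  push_cast
  rw [Finset.sum_sub_distrib, mul_sub]
  simp only [Finset.mul_sum]
  have e1 (a b : Fin m) (α β : ℂ) : ∑ i, -Complex.I * ((hessianChristoffel N T κ a i (imPart z) : ℂ)
      * (α * (-Complex.I * ((hessianChristoffel N T i b c (imPart z) : ℂ) * (β * γ))))) =
      - ∑ i, α * β * γ * ((hessianChristoffel N T κ a i (imPart z) : ℂ)
        * (hessianChristoffel N T i b c (imPart z) : ℂ)) := by
    rw [← Finset.sum_neg_distrib]
    refine Finset.sum_congr rfl fun i _ => ?_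
    linear_combination ((hessianChristoffel N T κ a i (imPart z) : ℂ) * α *
      (hessianChristoffel N T i b c (imPart z) : ℂ) * (β * γ)) * Complex.I_sq
  rw [e1, e1, mul_comm β α]
  ring

/-- Passing from (e_b, e_c) to (i e_b, i e_c) multiplies the product βγ in `riemann_single` by -1.
The quadratic terms and the ∂_a terms therefore cancel in the sum. Only the ∂_b term survives,
present for β = i alone and counted for both directions e_a and i e_a of the trace. -/
theorem ricci_add_ricci {z : Fin m → ℂ} (hz : imPart z ∈ U) (b c : Fin m) :
    ricci (tubeMetric H) z (Pi.single b 1) (Pi.single c 1)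
      + ricci (tubeMetric H) z (Pi.single b Complex.I) (Pi.single c Complex.I) =
    -2 * fderiv ℝ (fun x => ∑ a, hessianChristoffel N T a a c x) (imPart z) (Pi.single b 1) := by
  have hr (v w : Fin m → ℂ) : ricci (tubeMetric H) z v w =
      LinearMap.trace ℝ (Fin m → ℂ) (riemannEnd (tubeMetric H) z v w) := rfl
  have he (u v w : Fin m → ℂ) : riemannEnd (tubeMetric H) z v w u =
    riemann (tubeMetric H) z u v w := rfl
  rw [hr, hr, trace_complex_pi, trace_complex_pi, ← Finset.sum_add_distrib,
    fderiv_fun_sum fun a _ => h.differentiableAt_hessianChristoffel hz a a c]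
  simp only [he, h.riemann_single hz, sum_apply, Finset.mul_sum]
  refine Finset.sum_congr rfl fun a _ => ?_
  generalize (∑ l, (hessianChristoffel N T a a l (imPart z) * hessianChristoffel N T l b c (imPart z)
    - hessianChristoffel N T a b l (imPart z) * hessianChristoffel N T l a c (imPart z))) = q
  simp
  ring

/-- The metric uses the same matrix H on real and imaginary directions, so the trace only needs the
sum of Ricci values in `ricci_add_ricci`. -/
theorem scal_tubeMetric {z : Fin m → ℂ} (hz : imPart z ∈ U) :
    scal (tubeMetric H) z = -∑ b, ∑ c, N (imPart z) b c *
      fderiv ℝ (fun x => ∑ a, hessianChristoffel N T a a c x) (imPart z) (Pi.single b 1) := by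
  set x := imPart z with hx
  set X : (Fin m → ℂ) → Fin m → ℂ := fun v => (tubeMetric H z).inverse
    (LinearMap.toContinuousLinearMap (ricci (tubeMetric H) z v)) with hX
  have hgX (v w : Fin m → ℂ) : tubeMetric H z (X v) w = ricci (tubeMetric H) z v w := by
    rw [hX]
    simp only [(h.isRiemannian.isInvertible (p := z) hz).self_apply_inverse]
    rfl
  have hNH (f : Fin m → ℝ) (b : Fin m) : ∑ c, N x b c * ∑ μ, H x μ c * f μ = f b := by
    simp only [Finset.mul_sum]
    rw [Finset.sum_comm]
    have (μ : Fin m) : ∑ c, N x b c * (H x μ c * f μ) = (N x * H x) b μ * f μ := by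
      rw [Matrix.mul_apply, Finset.sum_mul]
      refine Finset.sum_congr rfl fun c _ => ?_
      rw [h.symm x hz μ c]; ring
    rw [Finset.sum_congr rfl fun μ _ => this μ, h.mul_eq_one x hz, Finset.sum_eq_single b]
    · simp
    · intro l _ hl
      simp [Matrix.one_apply_ne hl.symm]
    · simp
  have hre (v : Fin m → ℂ) (b : Fin m) :
      (X v b).re = ∑ c, N x b c * ricci (tubeMetric H) z v (Pi.single c 1) := by
    rw [← hNH (fun μ => (X v μ).re) b]
    refine Finset.sum_congr rfl fun c _ => ?_
    rw [← hgX, tubeMetric_apply]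
    congr 1
    refine Finset.sum_congr rfl fun μ _ => ?_
    rw [Finset.sum_eq_single c]
    · simp [hx]
    · intro l _ hl
      simp [hl]
    · simp
  have him (v : Fin m → ℂ) (b : Fin m) :
      (X v b).im = ∑ c, N x b c * ricci (tubeMetric H) z v (Pi.single c Complex.I) := by
    rw [← hNH (fun μ => (X v μ).im) b]
    refine Finset.sum_congr rfl fun c _ => ?_
    rw [← hgX, tubeMetric_apply]
    congr 1
    refine Finset.sum_congr rfl fun μ _ => ?_
    rw [Finset.sum_eq_single c]
    · simp [hx]
    · intro l _ hl
      simp [hl]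
    · simp
  rw [scal, trace_complex_pi]
  change 1 / 2 * ∑ b, ((X (Pi.single b 1) b).re + (X (Pi.single b Complex.I) b).im) = _
  simp only [hre, him, ← Finset.sum_add_distrib, ← mul_add, h.ricci_add_ricci hz]
  rw [Finset.mul_sum, ← Finset.sum_neg_distrib]
  refine Finset.sum_congr rfl fun b _ => ?_
  rw [Finset.mul_sum, ← Finset.sum_neg_distrib]
  refine Finset.sum_congr rfl fun c _ => ?_
  ring

end IsHessianField
end Tube

/-! ### The metric of the r-map as a Hessian metric -/

section Gradient

variable {m : ℕ}

/-- `f` is differentiable at `x` with partial derivatives `d`. -/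
def HasGrad (f : (Fin m → ℝ) → ℝ) (d : Fin m → ℝ) (x : Fin m → ℝ) : Prop :=
  HasFDerivAt f (∑ κ, d κ • (ContinuousLinearMap.proj κ : (Fin m → ℝ) →L[ℝ] ℝ)) x

theorem sum_smul_proj_single (d : Fin m → ℝ) (b : Fin m) :
    (∑ κ, d κ • (ContinuousLinearMap.proj κ : (Fin m → ℝ) →L[ℝ] ℝ)) (Pi.single b 1) = d b := by
  simp [sum_apply, Pi.single_apply]

theorem HasFDerivAt.hasGrad {f : (Fin m → ℝ) → ℝ} {d x : Fin m → ℝ} {L : (Fin m → ℝ) →L[ℝ] ℝ}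
    (hf : HasFDerivAt f L x) (hL : ∀ κ, L (Pi.single κ 1) = d κ) : HasGrad f d x := by
  refine hf.congr_fderiv (ContinuousLinearMap.coe_injective (LinearMap.pi_ext' fun κ => ?_))
  ext
  exact (hL κ).trans (sum_smul_proj_single d κ).symm

namespace HasGrad

variable {f g : (Fin m → ℝ) → ℝ} {d e : Fin m → ℝ} {x : Fin m → ℝ}

theorem hasFDerivAt (hf : HasGrad f d x) : HasFDerivAt f (∑ κ, d κ •
    (ContinuousLinearMap.proj κ : (Fin m → ℝ) →L[ℝ] ℝ)) x := hf

theorem fderiv_single (hf : HasGrad f d x) (b : Fin m) : fderiv ℝ f x (Pi.single b 1) = d b := by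
  rw [hf.hasFDerivAt.fderiv, sum_smul_proj_single]

theorem congr_grad (hf : HasGrad f d x) (h : ∀ κ, d κ = e κ) : HasGrad f e x := by
  rwa [← funext h]

theorem const_mul (hf : HasGrad f d x) (c : ℝ) : HasGrad (fun y => c * f y) (fun κ => c * d κ) x :=
  HasFDerivAt.hasGrad (hf.hasFDerivAt.const_mul c) fun κ => by
    rw [smul_apply, sum_smul_proj_single, smul_eq_mul]

theorem add (hf : HasGrad f d x) (hg : HasGrad g e x) :
    HasGrad (fun y => f y + g y) (fun κ => d κ + e κ) x :=
  HasFDerivAt.hasGrad (hf.hasFDerivAt.fun_add hg.hasFDerivAt) fun κ => by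
    rw [add_apply, sum_smul_proj_single, sum_smul_proj_single]

theorem mul (hf : HasGrad f d x) (hg : HasGrad g e x) :
    HasGrad (fun y => f y * g y) (fun κ => d κ * g x + f x * e κ) x :=
  HasFDerivAt.hasGrad (hf.hasFDerivAt.fun_mul hg.hasFDerivAt) fun κ => by
    rw [add_apply, smul_apply, smul_apply, sum_smul_proj_single, sum_smul_proj_single, smul_eq_mul,
      smul_eq_mul]
    ring

theorem inv (hf : HasGrad f d x) (h0 : f x ≠ 0) :
    HasGrad (fun y => (f y)⁻¹) (fun κ => -d κ / f x ^ 2) x :=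
  HasFDerivAt.hasGrad ((hasDerivAt_inv h0).comp_hasFDerivAt x hf.hasFDerivAt) fun κ => by
    rw [smul_apply, sum_smul_proj_single, smul_eq_mul]
    ring

theorem congr_of_eventuallyEq (hf : HasGrad f d x) (h : g =ᶠ[nhds x] f) : HasGrad g d x :=
  HasFDerivAt.congr_of_eventuallyEq hf h

end HasGrad

open MvPolynomial

theorem hasGrad_eval (p : MvPolynomial (Fin m) ℝ) (x : Fin m → ℝ) :
    HasGrad (fun y => eval y p) (fun κ => eval x (pderiv κ p)) x := by
  induction p using MvPolynomial.induction_on with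
  | C a =>
    simp only [eval_C, pderiv_C, map_zero]
    unfold HasGrad
    simpa using hasFDerivAt_const (𝕜 := ℝ) a x
  | add p q hp hq =>
    simp only [map_add]
    exact hp.add hq
  | mul_X p i hp =>
    have hX : HasGrad (fun y : Fin m → ℝ => y i) (fun κ => if κ = i then 1 else 0) x :=
      HasFDerivAt.hasGrad (ContinuousLinearMap.proj i : (Fin m → ℝ) →L[ℝ] ℝ).hasFDerivAt
        fun κ => by simp [Pi.single_apply, eq_comm]
    simp only [map_mul, eval_X]
    refine (hp.mul hX).congr_grad fun κ => ?_
    rw [Derivation.leibniz]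
    by_cases hκ : κ = i
    · subst hκ; simp; ring
    · simp [pderiv_X_of_ne (Ne.symm hκ), hκ]; ring

theorem contDiff_eval (p : MvPolynomial (Fin m) ℝ) :
    ContDiff ℝ ∞ (fun y => eval y p) := by
  induction p using MvPolynomial.induction_on with
  | C a => simpa using contDiff_const
  | add p q hp hq => simpa using hp.add hq
  | mul_X p i hp => simpa using hp.mul (contDiff_apply ℝ ℝ i)

/-- The commutator of two derivations is a derivation, and this one kills the variables. -/
theorem pderiv_comm (p : MvPolynomial (Fin m) ℝ) (i j : Fin m) :
    pderiv i (pderiv j p) = pderiv j (pderiv i p) := by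
  have h : ⁅(pderiv i : Derivation ℝ (MvPolynomial (Fin m) ℝ) (MvPolynomial (Fin m) ℝ)),
      (pderiv j : Derivation ℝ (MvPolynomial (Fin m) ℝ) (MvPolynomial (Fin m) ℝ))⁆ = 0 := by
    apply MvPolynomial.derivation_ext
    intro k
    rw [Derivation.commutator_apply]
    by_cases hi : k = i <;> by_cases hj : k = j <;> simp [pderiv_X, Pi.single_apply, hi, hj]
      <;> split_ifs <;> simp
  have := congrArg (fun d : Derivation ℝ (MvPolynomial (Fin m) ℝ) (MvPolynomial (Fin m) ℝ) => d p) h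
  simpa [Derivation.commutator_apply, sub_eq_zero] using this

end Gradient

section RMapHessian

open MvPolynomial

variable {m : ℕ} (h : MvPolynomial (Fin m) ℝ)

/-- Twice the coefficients `g_{μ \bar ν}`, the negative half of the Hessian of `log h`. -/
def logHessian (x : Fin m → ℝ) : Matrix (Fin m) (Fin m) ℝ :=
  Matrix.of fun μ ν => 2 * kahlerCoeff h x μ ν

/-- The partial derivatives `∂_κ` of `logHessian h`. -/
def logThird (x : Fin m → ℝ) (κ μ ν : Fin m) : ℝ :=
  -eval x (pderiv κ (pderiv μ (pderiv ν h))) / (2 * eval x h)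
    + (eval x (pderiv μ (pderiv ν h)) * eval x (pderiv κ h)
      + eval x (pderiv κ (pderiv μ h)) * eval x (pderiv ν h)
      + eval x (pderiv κ (pderiv ν h)) * eval x (pderiv μ h)) / (2 * eval x h ^ 2)
    - eval x (pderiv κ h) * eval x (pderiv μ h) * eval x (pderiv ν h) / eval x h ^ 3

theorem rMetric_eq_tubeMetric : rMetric h = tubeMetric (logHessian h) := rfl

theorem logHessian_apply (x : Fin m → ℝ) (hx : eval x h ≠ 0) (μ ν : Fin m) :
    logHessian h x μ ν = (-eval x h * eval x (pderiv μ (pderiv ν h))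
      + eval x (pderiv μ h) * eval x (pderiv ν h)) / (2 * eval x h ^ 2) := by
  simp only [logHessian, Matrix.of_apply, kahlerCoeff]
  field_simp
  ring

theorem logHessian_symm (x : Fin m → ℝ) (μ ν : Fin m) :
    logHessian h x μ ν = logHessian h x ν μ := by
  simp only [logHessian, Matrix.of_apply, kahlerCoeff]
  rw [pderiv_comm h μ ν, mul_comm (eval x (pderiv μ h))]

theorem logThird_symm_left (x : Fin m → ℝ) (κ μ ν : Fin m) :
    logThird h x κ μ ν = logThird h x μ κ ν := by
  simp only [logThird]
  rw [pderiv_comm _ κ μ, pderiv_comm h κ μ]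
  ring

theorem logThird_symm_right (x : Fin m → ℝ) (κ μ ν : Fin m) :
    logThird h x κ μ ν = logThird h x κ ν μ := by
  simp only [logThird]
  rw [pderiv_comm h μ ν]
  ring

theorem hasGrad_logHessian {x : Fin m → ℝ} (hx : eval x h ≠ 0) (μ ν : Fin m) :
    HasGrad (fun y => logHessian h y μ ν) (fun κ => logThird h x κ μ ν) x := by
  have h1 := hasGrad_eval h x
  have h2 := ((hasGrad_eval (pderiv μ (pderiv ν h)) x).mul (h1.inv hx)).const_mul (-(1 / 2))
  have h3 := (((hasGrad_eval (pderiv μ h) x).mul (hasGrad_eval (pderiv ν h) x)).mul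
    ((h1.mul h1).inv (mul_ne_zero hx hx))).const_mul (1 / 2)
  have h4 := (h2.add h3).congr_of_eventuallyEq (g := fun y => logHessian h y μ ν)
    (Filter.Eventually.of_forall fun y => by
      simp only [logHessian, Matrix.of_apply, kahlerCoeff, div_eq_mul_inv, mul_inv, pow_two]
      ring)
  refine h4.congr_grad fun κ => ?_
  simp only [logThird]
  field_simp
  ring

theorem differentiableAt_logThird {x : Fin m → ℝ} (hx : eval x h ≠ 0) (κ μ ν : Fin m) :
    DifferentiableAt ℝ (fun y => logThird h y κ μ ν) x := by
  have hd (p : MvPolynomial (Fin m) ℝ) : DifferentiableAt ℝ (fun y => eval y p) x :=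
    (hasGrad_eval p x).hasFDerivAt.differentiableAt
  have h1 : 2 * eval x h ≠ 0 := by simpa using hx
  have h2 : 2 * eval x h ^ 2 ≠ 0 := by simpa using hx
  have h3 : eval x h ^ 3 ≠ 0 := by simpa using hx
  unfold logThird
  have i1 := ((hd h).const_mul 2).fun_inv h1
  have i2 := (((hd h).fun_pow 2).const_mul 2).fun_inv h2
  have i3 := ((hd h).fun_pow 3).fun_inv h3
  simp only [div_eq_mul_inv]
  exact (((hd _).fun_neg.fun_mul i1).fun_add (((((hd _).fun_mul (hd _)).fun_add
    ((hd _).fun_mul (hd _))).fun_add ((hd _).fun_mul (hd _))).fun_mul i2)).fun_sub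
    ((((hd _).fun_mul (hd _)).fun_mul (hd _)).fun_mul i3)

variable {h}

/-- The matrix of second partial derivatives. -/
def hessian (h : MvPolynomial (Fin m) ℝ) : Matrix (Fin m) (Fin m) (MvPolynomial (Fin m) ℝ) :=
  Matrix.of fun μ ν => pderiv μ (pderiv ν h)

/-- `h` is positive and has a positive definite negative logarithmic Hessian on the open
set `U`. -/
structure IsHyperbolicOn (h : MvPolynomial (Fin m) ℝ) (U : Set (Fin m → ℝ)) : Prop where
  isOpen : IsOpen U
  pos : ∀ x ∈ U, 0 < eval x h
  posDef : ∀ x ∈ U, ∀ v : Fin m → ℝ, v ≠ 0 → 0 < ∑ μ, ∑ ν,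
    (-eval x h * eval x (pderiv μ (pderiv ν h)) + eval x (pderiv μ h) * eval x (pderiv ν h))
      * (v μ * v ν)

theorem IsHyperbolicOn.isRiemannian {U : Set (Fin m → ℝ)} (hU : IsHyperbolicOn h U) :
    IsRiemannian (imPart ⁻¹' U) (rMetric h) where
  isOpen := hU.isOpen.preimage imPart.continuous
  contDiffOn := by
    intro z hz
    have hx := (hU.pos _ hz).ne'
    have hd (p : MvPolynomial (Fin m) ℝ) : ContDiffAt ℝ ∞ (fun z => eval (imPart z) p) z :=
      ((contDiff_eval p).comp imPart.contDiff).contDiffAt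
    apply ContDiffAt.contDiffWithinAt
    rw [rMetric_eq_tubeMetric]
    unfold tubeMetric
    refine ContDiffAt.sum fun μ _ => ContDiffAt.sum fun ν _ => ContDiffAt.fun_smul ?_ contDiffAt_const
    simp only [logHessian, Matrix.of_apply, kahlerCoeff]
    refine contDiffAt_const.mul (((hd _).neg.div (contDiffAt_const.mul (hd _)) ?_).add
      (((hd _).mul (hd _)).div (contDiffAt_const.mul ((hd _).pow 2)) ?_))
    · simpa using hx
    · simpa using hx
  symm z hz v w := by
    rw [rMetric_eq_tubeMetric, tubeMetric_apply, tubeMetric_apply, Finset.sum_comm]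
    refine Finset.sum_congr rfl fun μ _ => Finset.sum_congr rfl fun ν _ => ?_
    rw [logHessian_symm]
    ring
  pos z hz v hv := by
    have hx := hU.pos _ hz
    set Q : (Fin m → ℝ) → ℝ := fun v => ∑ μ, ∑ ν,
      (-eval (imPart z) h * eval (imPart z) (pderiv μ (pderiv ν h))
        + eval (imPart z) (pderiv μ h) * eval (imPart z) (pderiv ν h)) * (v μ * v ν) with hQ
    have hQ0 (w : Fin m → ℝ) : 0 ≤ Q w := by
      by_cases hw : w = 0
      · simp [hQ, hw]
      · exact (hU.posDef _ hz w hw).le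
    have hsum : rMetric h z v v =
        (Q (fun μ => (v μ).re) + Q (imPart v)) / (2 * eval (imPart z) h ^ 2) := by
      rw [rMetric_eq_tubeMetric, tubeMetric_apply]
      simp only [hQ, ← Finset.sum_add_distrib, Finset.sum_div]
      refine Finset.sum_congr rfl fun μ _ => Finset.sum_congr rfl fun ν _ => ?_
      rw [logHessian_apply _ _ hx.ne', imPart_apply, imPart_apply]
      ring
    rw [hsum]
    refine div_pos ?_ (by positivity)
    by_cases hr : (fun μ => (v μ).re) = 0
    · refine add_pos_of_nonneg_of_pos (hQ0 _) (hU.posDef _ hz _ fun hi => hv ?_)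
      ext μ
      exact Complex.ext (congrFun hr μ) (congrFun hi μ)
    · exact add_pos_of_pos_of_nonneg (hU.posDef _ hz _ hr) (hQ0 _)

end RMapHessian

/-! ### Scalar curvature for a homogeneous ternary cubic -/

section CubicScal

open MvPolynomial

variable {h : MvPolynomial (Fin 3) ℝ}

theorem euler_eval {m n : ℕ} {p : MvPolynomial (Fin m) ℝ} (hp : p.IsHomogeneous n)
    (x : Fin m → ℝ) : ∑ i, x i * eval x (pderiv i p) = n * eval x p := by
  have := congrArg (eval x) hp.sum_X_mul_pderiv
  simpa using this

theorem hessian_mulVec (hh : h.IsHomogeneous 3) (x : Fin 3 → ℝ) (j : Fin 3) :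
    ∑ i, x i * eval x (pderiv i (pderiv j h)) = 2 * eval x (pderiv j h) := by
  simpa using euler_eval (hh.pderiv (i := j)) x

/-- The inverse of `logHessian h`. -/
def logHessianInv (h : MvPolynomial (Fin 3) ℝ) (x : Fin 3 → ℝ) : Matrix (Fin 3) (Fin 3) ℝ :=
  Matrix.of fun μ ν => -2 * eval x h * eval x ((hessian h).adjugate μ ν)
    * (eval x (hessian h).det)⁻¹ + x μ * x ν

theorem sum_adjugate_mul (h : MvPolynomial (Fin 3) ℝ) (x : Fin 3 → ℝ) (i j : Fin 3) :
    ∑ k, eval x ((hessian h).adjugate i k) * eval x (pderiv k (pderiv j h)) =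
      if i = j then eval x (hessian h).det else 0 := by
  have h1 := congrArg (eval x) (congrFun₂ (Matrix.adjugate_mul (hessian h)) i j)
  rw [Matrix.mul_apply, Matrix.smul_apply, Matrix.one_apply, map_sum] at h1
  simp only [map_mul, smul_eq_mul] at h1
  rw [show (∑ k, eval x ((hessian h).adjugate i k) * eval x (pderiv k (pderiv j h))) =
    ∑ k, eval x ((hessian h).adjugate i k) * eval x (hessian h k j) from rfl, h1]
  split_ifs <;> simp

/-- Euler's identity for the first partials reads (∂²h) x = 2∇h; multiply by the adjugate. -/
theorem two_mul_adjugate_mulVec (hh : h.IsHomogeneous 3) (x : Fin 3 → ℝ) (i : Fin 3) :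
    2 * ∑ k, eval x ((hessian h).adjugate i k) * eval x (pderiv k h) =
      eval x (hessian h).det * x i := by
  have h1 : 2 * ∑ k, eval x ((hessian h).adjugate i k) * eval x (pderiv k h) =
      ∑ j, x j * ∑ k, eval x ((hessian h).adjugate i k) * eval x (pderiv k (pderiv j h)) := by
    simp only [Finset.mul_sum]
    rw [Finset.sum_comm]
    refine Finset.sum_congr rfl fun k _ => ?_
    rw [mul_left_comm, ← hessian_mulVec hh, Finset.mul_sum]
    refine Finset.sum_congr rfl fun j _ => ?_
    rw [pderiv_comm]; ring
  rw [h1]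
  simp [sum_adjugate_mul, mul_comm]

/-- Jacobi's formula for the derivative of a determinant, expanded in size three. -/
theorem pderiv_det_hessian (h : MvPolynomial (Fin 3) ℝ) (c : Fin 3) :
    pderiv c (hessian h).det =
      ∑ i, ∑ j, (hessian h).adjugate i j * pderiv c (pderiv j (pderiv i h)) := by
  rw [Matrix.det_fin_three, Matrix.adjugate_fin_three]
  simp only [hessian, Matrix.of_apply, map_sub, map_add, Derivation.leibniz, smul_eq_mul,
    Fin.sum_univ_three, Matrix.cons_val]
  ring

theorem isHomogeneous_det_hessian (hh : h.IsHomogeneous 3) : (hessian h).det.IsHomogeneous 3 := by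
  have h1 (i j : Fin 3) : (hessian h i j).IsHomogeneous 1 := hh.pderiv.pderiv
  have h3 (i j k l p q : Fin 3) :
      (hessian h i j * hessian h k l * hessian h p q).IsHomogeneous 3 :=
    ((h1 i j).mul (h1 k l)).mul (h1 p q)
  rw [Matrix.det_fin_three]
  exact (((((h3 _ _ _ _ _ _).sub (h3 _ _ _ _ _ _)).sub (h3 _ _ _ _ _ _)).add
    (h3 _ _ _ _ _ _)).add (h3 _ _ _ _ _ _)).sub (h3 _ _ _ _ _ _)

theorem logHessianInv_mulVec (hh : h.IsHomogeneous 3) {x : Fin 3 → ℝ}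
    (hD : eval x (hessian h).det ≠ 0) (i : Fin 3) :
    ∑ k, logHessianInv h x i k * eval x (pderiv k h) = 2 * eval x h * x i := by
  have h1 := two_mul_adjugate_mulVec hh x i
  have h2 := euler_eval hh x
  simp only [logHessianInv, Matrix.of_apply, add_mul, Finset.sum_add_distrib]
  rw [show (∑ k, -2 * eval x h * eval x ((hessian h).adjugate i k) * (eval x (hessian h).det)⁻¹
      * eval x (pderiv k h)) = -eval x h * (eval x (hessian h).det)⁻¹ *
      (2 * ∑ k, eval x ((hessian h).adjugate i k) * eval x (pderiv k h)) by
    simp only [Finset.mul_sum]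
    exact Finset.sum_congr rfl fun k _ => by ring, h1,
    show (∑ k, x i * x k * eval x (pderiv k h)) = x i * ∑ k, x k * eval x (pderiv k h) by
    simp only [Finset.mul_sum]
    exact Finset.sum_congr rfl fun k _ => by ring, h2]
  field_simp
  push_cast
  ring

theorem sum_logHessianInv_mul (h : MvPolynomial (Fin 3) ℝ) (x : Fin 3 → ℝ)
    (X : Fin 3 → Fin 3 → ℝ) :
    ∑ i, ∑ j, logHessianInv h x i j * X i j =
      -2 * eval x h * (eval x (hessian h).det)⁻¹ *
        ∑ i, ∑ j, eval x ((hessian h).adjugate i j) * X i j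
      + ∑ i, x i * ∑ j, x j * X i j := by
  simp only [logHessianInv, Matrix.of_apply, Finset.mul_sum, ← Finset.sum_add_distrib]
  refine Finset.sum_congr rfl fun i _ => Finset.sum_congr rfl fun j _ => ?_
  ring

/-- This is the Sherman–Morrison formula for -∂²h/(2h) + ∇h ∇hᵀ/(2h²). Here (∂²h)⁻¹∇h = x/2 and x ·
∇h = 3h, so the denominator is 1 - 3/2 = -1/2 and the correction is exactly x xᵀ. -/
theorem logHessianInv_mul_logHessian (hh : h.IsHomogeneous 3) {x : Fin 3 → ℝ}
    (hx : eval x h ≠ 0) (hD : eval x (hessian h).det ≠ 0) :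
    logHessianInv h x * logHessian h x = 1 := by
  ext i j
  have h1 := logHessianInv_mulVec hh hD i
  have h2 : ∑ k, logHessianInv h x i k * eval x (pderiv k (pderiv j h)) =
      -2 * eval x h * (if i = j then 1 else 0) + 2 * x i * eval x (pderiv j h) := by
    simp only [logHessianInv, Matrix.of_apply, add_mul, Finset.sum_add_distrib]
    rw [show (∑ k, -2 * eval x h * eval x ((hessian h).adjugate i k) * (eval x (hessian h).det)⁻¹
        * eval x (pderiv k (pderiv j h))) = -2 * eval x h * (eval x (hessian h).det)⁻¹ *
        (∑ k, eval x ((hessian h).adjugate i k) * eval x (pderiv k (pderiv j h))) by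
      simp only [Finset.mul_sum]
      exact Finset.sum_congr rfl fun k _ => by ring, sum_adjugate_mul,
      show (∑ k, x i * x k * eval x (pderiv k (pderiv j h))) =
        x i * ∑ k, x k * eval x (pderiv k (pderiv j h)) by
      simp only [Finset.mul_sum]
      exact Finset.sum_congr rfl fun k _ => by ring, hessian_mulVec hh]
    split_ifs
    · field_simp
    · ring
  rw [Matrix.mul_apply]
  have h3 : ∑ k, logHessianInv h x i k * logHessian h x k j =
      (2 * eval x h ^ 2)⁻¹ * (-eval x h * ∑ k, logHessianInv h x i k
        * eval x (pderiv k (pderiv j h)) + eval x (pderiv j h) *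
        ∑ k, logHessianInv h x i k * eval x (pderiv k h)) := by
    simp only [Finset.mul_sum, ← Finset.sum_add_distrib]
    refine Finset.sum_congr rfl fun k _ => ?_
    rw [logHessian_apply _ _ hx]
    ring
  rw [h3, h2, h1, Matrix.one_apply]
  field_simp
  ring

theorem sum_logHessianInv_hessian (hh : h.IsHomogeneous 3) {x : Fin 3 → ℝ}
    (hD : eval x (hessian h).det ≠ 0) :
    ∑ i, ∑ j, logHessianInv h x i j * eval x (pderiv j (pderiv i h)) = 0 := by
  have h1 := euler_eval hh x
  have h2 (i : Fin 3) := sum_adjugate_mul h x i i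
  have h3 (i : Fin 3) := hessian_mulVec hh x i
  simp only [if_true] at h2
  rw [sum_logHessianInv_mul]
  simp only [h2, h3]
  rw [show (∑ i, x i * (2 * eval x (pderiv i h))) = 2 * ∑ i, x i * eval x (pderiv i h) by
    rw [Finset.mul_sum]
    exact Finset.sum_congr rfl fun i _ => by ring, h1]
  simp
  field_simp
  ring

/-- The adjugate part is ∂_c D by Jacobi's formula; the x xᵀ part is Euler's identity used twice,
the inner time on the linear forms ∂_c ∂_i h. -/
theorem sum_logHessianInv_third (hh : h.IsHomogeneous 3) {x : Fin 3 → ℝ} (c : Fin 3) :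
    ∑ i, ∑ j, logHessianInv h x i j * eval x (pderiv c (pderiv j (pderiv i h))) =
      -2 * eval x h * (eval x (hessian h).det)⁻¹ * eval x (pderiv c (hessian h).det)
        + 2 * eval x (pderiv c h) := by
  have h1 := congrArg (eval x) (pderiv_det_hessian h c)
  simp only [map_sum, map_mul] at h1
  rw [sum_logHessianInv_mul, ← h1, ← hessian_mulVec hh]
  congr 1
  refine Finset.sum_congr rfl fun i _ => ?_
  have h2 := euler_eval ((hh.pderiv (i := i)).pderiv (i := c)) x
  simp only [Nat.add_one_sub_one, Nat.cast_one, one_mul] at h2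
  rw [pderiv_comm h i c, ← h2]
  congr 1
  refine Finset.sum_congr rfl fun j _ => ?_
  rw [pderiv_comm _ c j]

/-- The right side is ½ ∂_c log(D h⁻³). It is the expected ½ ∂_c log det H, as det H is a constant
multiple of D h⁻³; the proof contracts the terms of `logThird` with N one by one instead. -/
theorem trace_logThird (hh : h.IsHomogeneous 3) {x : Fin 3 → ℝ} (hx : eval x h ≠ 0)
    (hD : eval x (hessian h).det ≠ 0) (c : Fin 3) :
    ∑ a, hessianChristoffel (logHessianInv h) (logThird h) a a c x =
      1 / 2 * (eval x (pderiv c (hessian h).det) * (eval x (hessian h).det)⁻¹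
        + -3 * (eval x (pderiv c h) * (eval x h)⁻¹)) := by
  have hN := logHessianInv_mulVec hh hD
  have s1 := sum_logHessianInv_third hh (x := x) c
  have s3 := sum_logHessianInv_hessian hh hD
  have s2 : ∑ i, ∑ j, logHessianInv h x i j * (eval x (pderiv i (pderiv c h))
      * eval x (pderiv j h)) = 4 * eval x h * eval x (pderiv c h) := by
    have (i : Fin 3) : ∑ j, logHessianInv h x i j * (eval x (pderiv i (pderiv c h))
        * eval x (pderiv j h)) = 2 * eval x h * (x i * eval x (pderiv i (pderiv c h))) := by
      rw [show 2 * eval x h * (x i * eval x (pderiv i (pderiv c h))) =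
        eval x (pderiv i (pderiv c h)) * (2 * eval x h * x i) by ring, ← hN, Finset.mul_sum]
      exact Finset.sum_congr rfl fun j _ => by ring
    simp only [this, ← Finset.mul_sum, hessian_mulVec hh]
    ring
  have hNs (i j : Fin 3) : logHessianInv h x i j = logHessianInv h x j i := by
    have hs : (hessian h).transpose = hessian h :=
      Matrix.ext fun i j => pderiv_comm _ _ _
    have : (hessian h).adjugate i j = (hessian h).adjugate j i := by
      conv_rhs => rw [← hs, ← Matrix.adjugate_transpose, Matrix.transpose_apply]
    simp only [logHessianInv, Matrix.of_apply, this]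
    ring
  have s4 : ∑ i, ∑ j, logHessianInv h x i j * (eval x (pderiv j (pderiv c h))
      * eval x (pderiv i h)) = 4 * eval x h * eval x (pderiv c h) := by
    rw [← s2, Finset.sum_comm]
    exact Finset.sum_congr rfl fun i _ => Finset.sum_congr rfl fun j _ => by rw [hNs]
  have s5 : ∑ i, ∑ j, logHessianInv h x i j * (eval x (pderiv i h)
      * eval x (pderiv j h)) = 6 * eval x h ^ 2 := by
    have (i : Fin 3) : ∑ j, logHessianInv h x i j * (eval x (pderiv i h)
        * eval x (pderiv j h)) = 2 * eval x h * (x i * eval x (pderiv i h)) := by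
      rw [show 2 * eval x h * (x i * eval x (pderiv i h)) =
        eval x (pderiv i h) * (2 * eval x h * x i) by ring, ← hN, Finset.mul_sum]
      exact Finset.sum_congr rfl fun j _ => by ring
    simp only [this, ← Finset.mul_sum, euler_eval hh]
    push_cast
    ring
  have hT (i j : Fin 3) : logThird h x j i c = -(2 * eval x h)⁻¹ *
      eval x (pderiv c (pderiv j (pderiv i h)))
      + (2 * eval x h ^ 2)⁻¹ * (eval x (pderiv i (pderiv c h)) * eval x (pderiv j h)
        + eval x (pderiv c h) * eval x (pderiv j (pderiv i h))
        + eval x (pderiv j (pderiv c h)) * eval x (pderiv i h))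
      - eval x (pderiv c h) * (eval x h ^ 3)⁻¹ * (eval x (pderiv i h) * eval x (pderiv j h)) := by
    simp only [logThird]
    rw [pderiv_comm h i c, pderiv_comm _ j c]
    ring
  have e : ∑ a, hessianChristoffel (logHessianInv h) (logThird h) a a c x =
      1 / 2 * (-(2 * eval x h)⁻¹ * (∑ i, ∑ j, logHessianInv h x i j *
          eval x (pderiv c (pderiv j (pderiv i h))))
      + (2 * eval x h ^ 2)⁻¹ * ((∑ i, ∑ j, logHessianInv h x i j * (eval x (pderiv i (pderiv c h))
      * eval x (pderiv j h))) + eval x (pderiv c h) *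
        (∑ i, ∑ j, logHessianInv h x i j * eval x (pderiv j (pderiv i h)))
        + (∑ i, ∑ j, logHessianInv h x i j * (eval x (pderiv j (pderiv c h))
      * eval x (pderiv i h))))
      - eval x (pderiv c h) * (eval x h ^ 3)⁻¹ * (∑ i, ∑ j, logHessianInv h x i j *
        (eval x (pderiv i h) * eval x (pderiv j h)))) := by
    simp only [hessianChristoffel, hT, Finset.mul_sum, ← Finset.sum_add_distrib,
      ← Finset.sum_sub_distrib]
    exact Finset.sum_congr rfl fun i _ => Finset.sum_congr rfl fun j _ => by ring
  rw [e, s1, s2, s3, s4, s5]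
  field_simp
  ring

variable {U : Set (Fin 3 → ℝ)}

theorem IsHyperbolicOn.isHessianField (hU : IsHyperbolicOn h U) (hh : h.IsHomogeneous 3)
    (hD : ∀ x ∈ U, eval x (hessian h).det ≠ 0) :
    IsHessianField U (logHessian h) (logHessianInv h) (logThird h) where
  isOpen := hU.isOpen
  symm x _ μ ν := logHessian_symm h x μ ν
  mul_eq_one x hx := logHessianInv_mul_logHessian hh (hU.pos x hx).ne' (hD x hx)
  hasFDerivAt x hx μ ν := hasGrad_logHessian h (hU.pos x hx).ne' μ ν
  symm_left x _ := logThird_symm_left h x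
  symm_right x _ := logThird_symm_right h x
  differentiableAt_inv x hx μ ν := by
    have hd (p : MvPolynomial (Fin 3) ℝ) : DifferentiableAt ℝ (fun y => eval y p) x :=
      (hasGrad_eval p x).hasFDerivAt.differentiableAt
    have hi := (hd (hessian h).det).fun_inv (hD x hx)
    simp only [logHessianInv, Matrix.of_apply]
    exact ((((hd h).const_mul (-2)).fun_mul (hd _)).fun_mul hi).fun_add
      ((differentiableAt_apply μ x).fun_mul (differentiableAt_apply ν x))
  differentiableAt_third x hx := differentiableAt_logThird h (hU.pos x hx).ne'
  isRiemannian := hU.isRiemannian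

/-- Contracting N with the Hessian of log h gives -6, whence the constant -9 from h⁻³. The x xᵀ part
of N acting on log D adds 3/2, and the adjugate part yields the fraction. -/
theorem IsHyperbolicOn.scal_rMetric (hU : IsHyperbolicOn h U) (hh : h.IsHomogeneous 3)
    (hD : ∀ x ∈ U, eval x (hessian h).det ≠ 0) {z : Fin 3 → ℂ} (hz : imPart z ∈ U) :
    scal (rMetric h) z = -(15 / 2) + eval (imPart z) h *
      (∑ b, ∑ c, eval (imPart z) ((hessian h).adjugate b c) *
        (eval (imPart z) (hessian h).det * eval (imPart z) (pderiv b (pderiv c (hessian h).det))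
        - eval (imPart z) (pderiv b (hessian h).det) * eval (imPart z) (pderiv c (hessian h).det)))
      / eval (imPart z) (hessian h).det ^ 3 := by
  rw [rMetric_eq_tubeMetric, (hU.isHessianField hh hD).scal_tubeMetric hz]
  set x := imPart z with hx
  set D := (hessian h).det with hDdef
  have hx0 := (hU.pos x hz).ne'
  have hD0 := hD x hz
  have hDh : D.IsHomogeneous 3 := isHomogeneous_det_hessian hh
  have hg (c : Fin 3) : HasGrad (fun y => ∑ a, hessianChristoffel (logHessianInv h) (logThird h)
      a a c y) (fun b => 1 / 2 * (eval x (pderiv b (pderiv c D)) * (eval x D)⁻¹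
        - eval x (pderiv b D) * eval x (pderiv c D) * (eval x D)⁻¹ ^ 2
        - 3 * (eval x (pderiv c (pderiv b h)) * (eval x h)⁻¹
        - eval x (pderiv b h) * eval x (pderiv c h) * (eval x h)⁻¹ ^ 2))) x := by
    have h1 := (((hasGrad_eval (pderiv c D) x).mul ((hasGrad_eval D x).inv hD0)).add
      (((hasGrad_eval (pderiv c h) x).mul ((hasGrad_eval h x).inv hx0)).const_mul
        (-3))).const_mul (1 / 2)
    refine (h1.congr_of_eventuallyEq ?_).congr_grad fun b => ?_
    · filter_upwards [hU.isOpen.mem_nhds hz] with y hy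
      exact trace_logThird hh (hU.pos y hy).ne' (hD y hy) c
    · rw [pderiv_comm h c b]
      ring
  simp only [(hg _).fderiv_single]
  have s1 := sum_logHessianInv_hessian hh hD0
  have hN := logHessianInv_mulVec hh hD0
  have s2 : ∑ i, ∑ j, logHessianInv h x i j * (eval x (pderiv i h)
      * eval x (pderiv j h)) = 6 * eval x h ^ 2 := by
    have (i : Fin 3) : ∑ j, logHessianInv h x i j * (eval x (pderiv i h)
        * eval x (pderiv j h)) = 2 * eval x h * (x i * eval x (pderiv i h)) := by
      rw [show 2 * eval x h * (x i * eval x (pderiv i h)) =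
        eval x (pderiv i h) * (2 * eval x h * x i) by ring, ← hN, Finset.mul_sum]
      exact Finset.sum_congr rfl fun j _ => by ring
    simp only [this, ← Finset.mul_sum, euler_eval hh]
    push_cast
    ring
  have s3 := sum_logHessianInv_mul h x fun i j => eval x (pderiv i (pderiv j D))
  have s4 := sum_logHessianInv_mul h x fun i j => eval x (pderiv i D) * eval x (pderiv j D)
  -- D is again a cubic, so Euler gives 3·2·D here and (3D)² in `e4`; the difference 6D² - 9D² =
  -- -3D² accounts for the contribution 3/2.
  have e3 : ∑ i, x i * ∑ j, x j * eval x (pderiv i (pderiv j D)) = 6 * eval x D := by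
    have (i : Fin 3) : ∑ j, x j * eval x (pderiv i (pderiv j D)) = 2 * eval x (pderiv i D) := by
      rw [← Nat.cast_two, ← euler_eval (hDh.pderiv (i := i)) x]
      exact Finset.sum_congr rfl fun j _ => by rw [pderiv_comm]
    simp only [this, mul_left_comm _ (2 : ℝ), ← Finset.mul_sum, euler_eval hDh]
    push_cast
    ring
  have e4 : ∑ i, x i * ∑ j, x j * (eval x (pderiv i D) * eval x (pderiv j D)) =
      9 * eval x D ^ 2 := by
    simp only [mul_left_comm (x _) (eval x (pderiv _ D)), ← Finset.mul_sum, euler_eval hDh]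
    rw [show ∑ i, eval x (pderiv i D) * (x i * ((3 : ℕ) * eval x D)) =
      (3 : ℕ) * eval x D * ∑ i, x i * eval x (pderiv i D) by
      rw [Finset.mul_sum]
      exact Finset.sum_congr rfl fun i _ => by ring, euler_eval hDh]
    push_cast
    ring
  rw [e3, ← hDdef] at s3
  rw [e4, ← hDdef] at s4
  have e : -∑ b, ∑ c, logHessianInv h x b c * (1 / 2 * (eval x (pderiv b (pderiv c D))
        * (eval x D)⁻¹
        - eval x (pderiv b D) * eval x (pderiv c D) * (eval x D)⁻¹ ^ 2
        - 3 * (eval x (pderiv c (pderiv b h)) * (eval x h)⁻¹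
        - eval x (pderiv b h) * eval x (pderiv c h) * (eval x h)⁻¹ ^ 2))) =
      -(1 / 2) * ((eval x D)⁻¹ * (∑ i, ∑ j, logHessianInv h x i j * eval x (pderiv i (pderiv j D)))
        - (eval x D)⁻¹ ^ 2 * (∑ i, ∑ j, logHessianInv h x i j *
          (eval x (pderiv i D) * eval x (pderiv j D)))
        - 3 * ((eval x h)⁻¹ * (∑ i, ∑ j, logHessianInv h x i j *
          eval x (pderiv j (pderiv i h))) - (eval x h)⁻¹ ^ 2 *
          (∑ i, ∑ j, logHessianInv h x i j * (eval x (pderiv i h) * eval x (pderiv j h))))) := by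
    simp only [Finset.mul_sum, ← Finset.sum_sub_distrib, ← Finset.sum_neg_distrib]
    exact Finset.sum_congr rfl fun i _ => Finset.sum_congr rfl fun j _ => by ring
  have e' : (∑ b, ∑ c, eval x ((hessian h).adjugate b c) *
        (eval x D * eval x (pderiv b (pderiv c D)) - eval x (pderiv b D) * eval x (pderiv c D))) =
      eval x D * (∑ b, ∑ c, eval x ((hessian h).adjugate b c) * eval x (pderiv b (pderiv c D)))
      - ∑ b, ∑ c, eval x ((hessian h).adjugate b c) *
        (eval x (pderiv b D) * eval x (pderiv c D)) := by
    simp only [Finset.mul_sum, ← Finset.sum_sub_distrib]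
    exact Finset.sum_congr rfl fun i _ => Finset.sum_congr rfl fun j _ => by ring
  rw [e, e', s1, s2, s3, s4]
  field_simp
  ring

end CubicScal

/-! ### Hessians, determinants and contractions of the five cubics -/

section Labels

open MvPolynomial

theorem isHomogeneous_cubic (s : Label) : (cubic s).IsHomogeneous 3 := by
  have hX (i : Fin 3) : (X i : MvPolynomial (Fin 3) ℝ).IsHomogeneous 1 := isHomogeneous_X _ _
  have h2 (i : Fin 3) : (X i ^ 2 : MvPolynomial (Fin 3) ℝ).IsHomogeneous 2 := (hX i).pow 2
  have h11 (i j : Fin 3) : (X i * X j : MvPolynomial (Fin 3) ℝ).IsHomogeneous 2 :=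
    (hX i).mul (hX j)
  cases s
  · exact (h11 0 1).mul (hX 2)
  · exact (hX 0).mul ((h11 0 1).sub (h2 2))
  · exact (hX 0).mul ((h11 1 2).add (h2 0))
  · exact (hX 2).mul (((h2 0).add (h2 1)).sub (h2 2))
  · exact ((hX 0).mul ((h2 1).sub (h2 2))).add ((hX 1).pow 3)

@[simp] theorem pderiv_ofNat {m : ℕ} (i : Fin m) (n : ℕ) [n.AtLeastTwo] :
    pderiv i (ofNat(n) : MvPolynomial (Fin m) ℝ) = 0 :=
  Derivation.map_natCast _ n

theorem hessian_cubic_a : hessian (cubic Label.a) =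
    !![0, X 2, X 1; X 2, 0, X 0; X 1, X 0, 0] := by
  ext1 i j
  fin_cases i <;> fin_cases j <;> simp [hessian, cubic, pderiv_X, Pi.single_apply]

theorem hessian_cubic_b : hessian (cubic Label.b) =
    !![2 * X 1, 2 * X 0, -2 * X 2; 2 * X 0, 0, 0; -2 * X 2, 0, -2 * X 0] := by
  ext1 i j
  fin_cases i <;> fin_cases j <;> simp [hessian, cubic, pderiv_X, Pi.single_apply] <;> ring

theorem hessian_cubic_c : hessian (cubic Label.c) =
    !![6 * X 0, X 2, X 1; X 2, 0, X 0; X 1, X 0, 0] := by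
  ext1 i j
  fin_cases i <;> fin_cases j <;> simp [hessian, cubic, pderiv_X, Pi.single_apply]
  ring

theorem hessian_cubic_d : hessian (cubic Label.d) =
    !![2 * X 2, 0, 2 * X 0; 0, 2 * X 2, 2 * X 1; 2 * X 0, 2 * X 1, -6 * X 2] := by
  ext1 i j
  fin_cases i <;> fin_cases j <;> simp [hessian, cubic, pderiv_X, Pi.single_apply]
  all_goals ring

theorem hessian_cubic_e : hessian (cubic Label.e) =
    !![0, 2 * X 1, -2 * X 2; 2 * X 1, 2 * X 0 + 6 * X 1, 0; -2 * X 2, 0, -2 * X 0] := by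
  ext1 i j
  fin_cases i <;> fin_cases j <;> simp [hessian, cubic, pderiv_X, Pi.single_apply] <;> ring

theorem det_hessian_a : (hessian (cubic Label.a)).det =
    2 * (X 0 * X 1 * X 2) := by
  rw [hessian_cubic_a, Matrix.det_fin_three]
  simp
  ring

theorem det_hessian_b : (hessian (cubic Label.b)).det =
    8 * X 0 ^ 3 := by
  rw [hessian_cubic_b, Matrix.det_fin_three]
  simp
  ring

theorem det_hessian_c : (hessian (cubic Label.c)).det =
    2 * (X 0 * X 1 * X 2) - 6 * X 0 ^ 3 := by
  rw [hessian_cubic_c, Matrix.det_fin_three]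
  simp
  ring

theorem det_hessian_d : (hessian (cubic Label.d)).det =
    -8 * (X 2 * (X 0 ^ 2 + X 1 ^ 2)) - 24 * X 2 ^ 3 := by
  rw [hessian_cubic_d, Matrix.det_fin_three]
  simp
  ring

theorem det_hessian_e : (hessian (cubic Label.e)).det =
    8 * (X 0 * (X 1 ^ 2 - X 2 ^ 2)) - 24 * (X 1 * X 2 ^ 2) := by
  rw [hessian_cubic_e, Matrix.det_fin_three]
  simp
  ring

/-- The contraction of the cofactors of the Hessian of `h` with
`D ∂∂D - ∂D ∂D`, where `D` is the Hessian determinant of `h`. -/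
def hessianContraction (h : MvPolynomial (Fin 3) ℝ) (x : Fin 3 → ℝ) : ℝ :=
  ∑ b, ∑ c, eval x ((hessian h).adjugate b c) *
    (eval x (hessian h).det * eval x (pderiv b (pderiv c (hessian h).det))
      - eval x (pderiv b (hessian h).det) * eval x (pderiv c (hessian h).det))

theorem hessianContraction_a (x : Fin 3 → ℝ) : hessianContraction (cubic Label.a) x =
    12 * (x 0 * x 1 * x 2) ^ 2 := by
  rw [hessianContraction, det_hessian_a, hessian_cubic_a, Matrix.adjugate_fin_three]
  simp [Fin.sum_univ_three, pderiv_X, Pi.single_apply, Derivation.leibniz]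
  ring

theorem hessianContraction_b (x : Fin 3 → ℝ) : hessianContraction (cubic Label.b) x =
    0 := by
  rw [hessianContraction, det_hessian_b, hessian_cubic_b, Matrix.adjugate_fin_three]
  simp [Fin.sum_univ_three, pderiv_X, Pi.single_apply, Derivation.leibniz]

theorem hessianContraction_c (x : Fin 3 → ℝ) : hessianContraction (cubic Label.c) x =
    12 * x 0 ^ 2 * (21 * x 0 ^ 4 + 6 * x 0 ^ 2 * (x 1 * x 2) + (x 1 * x 2) ^ 2) := by
  rw [hessianContraction, det_hessian_c, hessian_cubic_c, Matrix.adjugate_fin_three]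
  simp [Fin.sum_univ_three, pderiv_X, Pi.single_apply, Derivation.leibniz]
  ring

theorem hessianContraction_d (x : Fin 3 → ℝ) : hessianContraction (cubic Label.d) x =
    -768 * x 2 ^ 2 * ((x 0 ^ 2 + x 1 ^ 2) ^ 2 - 6 * x 2 ^ 2 * (x 0 ^ 2 + x 1 ^ 2) + 21 * x 2 ^ 4) := by
  rw [hessianContraction, det_hessian_d, hessian_cubic_d, Matrix.adjugate_fin_three]
  simp [Fin.sum_univ_three, pderiv_X, Pi.single_apply, Derivation.leibniz]
  ring

theorem hessianContraction_e (x : Fin 3 → ℝ) : hessianContraction (cubic Label.e) x =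
    768 * (x 0 * (x 1 ^ 2 - x 2 ^ 2)) ^ 2 + 2304 * x 0 * x 1 * (x 1 ^ 4 - x 2 ^ 4)
      + 13824 * x 1 ^ 4 * x 2 ^ 2 + 2304 * x 2 ^ 6 := by
  rw [hessianContraction, det_hessian_e, hessian_cubic_e, Matrix.adjugate_fin_three]
  simp [Fin.sum_univ_three, pderiv_X, Pi.single_apply, Derivation.leibniz]
  ring

end Labels

/-! ### The cones and positive definiteness -/

section Domains

open MvPolynomial

/-- The coefficients of `h²` times the negative Hessian of `log h`. -/
def negLogForm (h : MvPolynomial (Fin 3) ℝ) (x : Fin 3 → ℝ) (μ ν : Fin 3) : ℝ :=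
  -eval x h * eval x (pderiv μ (pderiv ν h)) + eval x (pderiv μ h) * eval x (pderiv ν h)

theorem negLogForm_symm (h : MvPolynomial (Fin 3) ℝ) (x : Fin 3 → ℝ) (μ ν : Fin 3) :
    negLogForm h x μ ν = negLogForm h x ν μ := by
  rw [negLogForm, negLogForm, pderiv_comm h μ ν, mul_comm (eval x (pderiv μ h))]

/-- Sylvester's criterion for ternary forms. -/
theorem ternary_form_pos {a b c d e f : ℝ} (h1 : 0 < a) (h2 : 0 < a * d - b ^ 2)
    (h3 : 0 < a * d * f + 2 * b * c * e - a * e ^ 2 - d * c ^ 2 - f * b ^ 2) {u v w : ℝ}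
    (h0 : u ≠ 0 ∨ v ≠ 0 ∨ w ≠ 0) :
    0 < a * u ^ 2 + d * v ^ 2 + f * w ^ 2 + 2 * b * (u * v) + 2 * c * (u * w)
      + 2 * e * (v * w) := by
  -- After scaling by the first two leading minors, completing squares needs no division.
  refine pos_of_mul_pos_right (a := a * (a * d - b ^ 2)) ?_ (by positivity)
  have key : a * (a * d - b ^ 2) * (a * u ^ 2 + d * v ^ 2 + f * w ^ 2 + 2 * b * (u * v)
      + 2 * c * (u * w) + 2 * e * (v * w)) = (a * d - b ^ 2) * (a * u + b * v + c * w) ^ 2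
      + ((a * d - b ^ 2) * v + (a * e - b * c) * w) ^ 2
      + a * (a * d * f + 2 * b * c * e - a * e ^ 2 - d * c ^ 2 - f * b ^ 2) * w ^ 2 := by
    ring
  rw [key]
  by_cases hw : w = 0
  · by_cases hv : v = 0
    · have hu : u ≠ 0 := by simpa [hw, hv] using h0
      subst hw hv
      simp only [mul_zero, add_zero]
      positivity
    · have h4 : (a * d - b ^ 2) * v ≠ 0 := mul_ne_zero h2.ne' hv
      subst hw
      simp only [mul_zero, add_zero]
      positivity
  · positivity

/-- The open cone `{h > 0} ∩ region`. -/
def domain (s : Label) : Set (Fin 3 → ℝ) := {x | 0 < eval x (cubic s) ∧ x ∈ region s}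

theorem smul_mem_region (s : Label) {r : ℝ} (hr : 0 < r) {x : Fin 3 → ℝ} (hx : x ∈ region s) :
    r • x ∈ region s := by
  have hp {t : ℝ} (ht : 0 < t) : 0 < r * t := mul_pos hr ht
  have hn {t : ℝ} (ht : t < 0) : r * t < 0 := mul_neg_of_pos_of_neg hr ht
  cases s
  · exact ⟨hp hx.1, hp hx.2⟩
  · exact hp hx
  · exact ⟨hn hx.1, hp hx.2⟩
  · exact hn hx
  · exact ⟨hn hx.1, hp hx.2⟩

theorem eval_smul_cubic (s : Label) (r : ℝ) (x : Fin 3 → ℝ) :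
    eval (r • x) (cubic s) = r ^ 3 * eval x (cubic s) := by
  cases s <;> simp [cubic] <;> ring

/-- Homogeneity of degree 3: dividing a point by the cube root of h puts it on the level set h = 1,
and the sign conditions are invariant under positive scaling. -/
theorem cone_surface (s : Label) : cone (surface s) = domain s := by
  ext x
  constructor
  · rintro ⟨r, hr, p, ⟨hp, hps⟩, rfl⟩
    refine ⟨?_, smul_mem_region s hr hps⟩
    rw [eval_smul_cubic, hp]
    positivity
  · rintro ⟨hx, hxs⟩
    have hr : 0 < eval x (cubic s) ^ (1 / 3 : ℝ) := Real.rpow_pos_of_pos hx _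
    have hr3 : (eval x (cubic s) ^ (1 / 3 : ℝ)) ^ 3 = eval x (cubic s) := by
      rw [← Real.rpow_natCast, ← Real.rpow_mul hx.le]
      norm_num
    set r := eval x (cubic s) ^ (1 / 3 : ℝ)
    refine ⟨r, hr, r⁻¹ • x, ⟨?_, smul_mem_region s (inv_pos.2 hr) hxs⟩, ?_⟩
    · rw [eval_smul_cubic, inv_pow, hr3, inv_mul_cancel₀ hx.ne']
    · rw [smul_inv_smul₀ hr.ne']

theorem manifold_eq (s : Label) : manifold s = imPart ⁻¹' domain s := by
  rw [← cone_surface]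
  rfl

theorem isOpen_domain (s : Label) : IsOpen (domain s) := by
  refine IsOpen.inter (isOpen_lt continuous_const (continuous_eval _)) ?_
  have hp (i : Fin 3) : IsOpen {p : Fin 3 → ℝ | 0 < p i} :=
    isOpen_lt continuous_const (continuous_apply i)
  have hn (i : Fin 3) : IsOpen {p : Fin 3 → ℝ | p i < 0} :=
    isOpen_lt (continuous_apply i) continuous_const
  cases s
  · exact (hp 0).inter (hp 1)
  · exact hp 0
  · exact (hn 0).inter (hp 1)
  · exact hn 2
  · exact (hn 1).inter (hp 0)

/-- The order of the coordinates is left free so that the first minor can be taken in a convenient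
variable. For a cubic in three variables the full determinant equals ½ h³ D, which explains the
factorisations used for the third minor. -/
theorem isHyperbolicOn_domain_of_minors (s : Label) (i j k : Fin 3)
    (hijk : ∀ f : Fin 3 → ℝ, ∑ μ, f μ = f i + f j + f k)
    (h1 : ∀ x ∈ domain s, 0 < negLogForm (cubic s) x i i)
    (h2 : ∀ x ∈ domain s, 0 < negLogForm (cubic s) x i i * negLogForm (cubic s) x j j
      - negLogForm (cubic s) x i j ^ 2)
    (h3 : ∀ x ∈ domain s, 0 < negLogForm (cubic s) x i i * negLogForm (cubic s) x j j
        * negLogForm (cubic s) x k k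
      + 2 * negLogForm (cubic s) x i j * negLogForm (cubic s) x i k * negLogForm (cubic s) x j k
      - negLogForm (cubic s) x i i * negLogForm (cubic s) x j k ^ 2
      - negLogForm (cubic s) x j j * negLogForm (cubic s) x i k ^ 2
      - negLogForm (cubic s) x k k * negLogForm (cubic s) x i j ^ 2) :
    IsHyperbolicOn (cubic s) (domain s) where
  isOpen := isOpen_domain s
  pos _ hx := hx.1
  posDef x hx v hv := by
    have h0 : v i ≠ 0 ∨ v j ≠ 0 ∨ v k ≠ 0 := by
      by_contra! hc
      refine hv (funext fun μ => ?_)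
      -- Applied to squares, the summation rule `hijk` forces every coordinate to vanish, so `i`,
      -- `j`, `k` exhaust the indices.
      have := hijk fun μ => v μ ^ 2
      simp only [hc.1, hc.2.1, hc.2.2] at this
      norm_num at this
      rw [Finset.sum_eq_zero_iff_of_nonneg fun μ _ => sq_nonneg _] at this
      simpa using this μ (Finset.mem_univ μ)
    have := ternary_form_pos (h1 x hx) (h2 x hx) (h3 x hx) h0
    change 0 < ∑ μ, ∑ ν, negLogForm (cubic s) x μ ν * (v μ * v ν)
    simp only [hijk]
    rw [negLogForm_symm _ x j i, negLogForm_symm _ x k i, negLogForm_symm _ x k j]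
    linarith

theorem isHyperbolicOn_a : IsHyperbolicOn (cubic Label.a) (domain Label.a) := by
  refine isHyperbolicOn_domain_of_minors _ 0 1 2 Fin.sum_univ_three ?_ ?_ ?_
  all_goals
    rintro x ⟨hx, h0, h1⟩
    simp [negLogForm, cubic, pderiv_X] at hx ⊢
    have h2 : 0 < x 2 := pos_of_mul_pos_right hx (mul_pos h0 h1).le
  · exact ⟨h2.ne', h1.ne'⟩
  · ring_nf
    positivity
  · ring_nf
    positivity

theorem isHyperbolicOn_b : IsHyperbolicOn (cubic Label.b) (domain Label.b) := by
  -- The cubic is linear in y, so the first minor is the square (∂_y h)² = x⁴.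
  refine isHyperbolicOn_domain_of_minors _ 1 2 0 (fun f => by rw [Fin.sum_univ_three]; ring)
    ?_ ?_ ?_
  all_goals
    rintro x ⟨hx, h0⟩
    simp [negLogForm, cubic, pderiv_X] at hx ⊢
    replace h0 : 0 < x 0 := h0
    have h2 : 0 < x 0 * x 1 - x 2 ^ 2 := pos_of_mul_pos_right hx h0.le
  · positivity
  · have : 0 < 2 * x 0 ^ 6 * (x 0 * x 1 - x 2 ^ 2) := by positivity
    linarith
  · have : 0 < 4 * x 0 ^ 6 * (x 0 * x 1 - x 2 ^ 2) ^ 3 := by positivity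
    linarith

theorem isHyperbolicOn_c : IsHyperbolicOn (cubic Label.c) (domain Label.c) := by
  refine isHyperbolicOn_domain_of_minors _ 1 2 0 (fun f => by rw [Fin.sum_univ_three]; ring)
    ?_ ?_ ?_
  all_goals
    rintro x ⟨hx, h0, h1⟩
    simp [negLogForm, cubic, pderiv_X] at hx ⊢
    have h2 : x 1 * x 2 + x 0 ^ 2 < 0 := neg_of_mul_pos_right hx h0.le
    have h5 := h0.ne
    have h4 : 0 < x 0 ^ 2 := by positivity
  · have h3 : x 2 ≠ 0 := by rintro h3; rw [h3] at h2; linarith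
    exact ⟨h5, h3⟩
  · have : 0 < x 0 ^ 4 * ((x 1 * x 2 + x 0 ^ 2) * (x 1 * x 2 - x 0 ^ 2)) := by
      refine mul_pos (by positivity) (mul_pos_of_neg_of_neg h2 (by linarith))
    linarith
  · have : 0 < (x 0 * (x 1 * x 2 + x 0 ^ 2)) ^ 3 * (x 0 * (x 1 * x 2 - 3 * x 0 ^ 2)) :=
      mul_pos (pow_pos hx 3) (mul_pos_of_neg_of_neg h0 (by linarith))
    linarith

theorem isHyperbolicOn_d : IsHyperbolicOn (cubic Label.d) (domain Label.d) := by
  refine isHyperbolicOn_domain_of_minors _ 0 1 2 Fin.sum_univ_three ?_ ?_ ?_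
  all_goals
    rintro x ⟨hx, h0⟩
    simp [negLogForm, cubic, pderiv_X] at hx ⊢
    replace h0 : x 2 < 0 := h0
    have h2 : x 0 ^ 2 + x 1 ^ 2 - x 2 ^ 2 < 0 := neg_of_mul_pos_right hx h0.le
    have h5 := h0.ne
    have h4 : 0 < x 2 ^ 2 := by positivity
  -- Inside the cone y² < z² - x², so the last factor exceeds 2x².
  · have : 0 < 2 * x 2 ^ 2 * (x 0 ^ 2 - x 1 ^ 2 + x 2 ^ 2) :=
      mul_pos (by positivity) (by nlinarith [sq_nonneg (x 0)])
    linarith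
  · have : 0 < 4 * x 2 ^ 4 * (-(x 0 ^ 2 + x 1 ^ 2 - x 2 ^ 2) * (x 0 ^ 2 + x 1 ^ 2 + x 2 ^ 2)) :=
      mul_pos (by positivity) (mul_pos (by linarith) (by positivity))
    linarith
  · have : 0 < (x 2 * (x 0 ^ 2 + x 1 ^ 2 - x 2 ^ 2)) ^ 3 *
        (-(4 * x 2) * (x 0 ^ 2 + x 1 ^ 2 + 3 * x 2 ^ 2)) :=
      mul_pos (pow_pos hx 3) (mul_pos (by linarith) (by positivity))
    linarith

theorem isHyperbolicOn_e : IsHyperbolicOn (cubic Label.e) (domain Label.e) := by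
  -- The cubic is linear in x, so the first minor is (y² - z²)².
  refine isHyperbolicOn_domain_of_minors _ 0 2 1 (fun f => by rw [Fin.sum_univ_three]; ring)
    ?_ ?_ ?_
  all_goals
    rintro x ⟨hx, h1, h0⟩
    simp [negLogForm, cubic, pderiv_X] at hx ⊢
    have h3 : x 1 ^ 3 < 0 := Odd.pow_neg (by decide) h1
    have h4 : 0 < x 0 * (x 1 ^ 2 - x 2 ^ 2) := by linarith
    have h2 : 0 < x 1 ^ 2 - x 2 ^ 2 := pos_of_mul_pos_right h4 h0.le
    have h5 := h1.ne
  · positivity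
  · have : 0 < (x 0 * (x 1 ^ 2 - x 2 ^ 2) + x 1 ^ 3) * (2 * (x 1 ^ 2 + x 2 ^ 2) *
        (x 0 * (x 1 ^ 2 - x 2 ^ 2)) + 4 * (-x 1 ^ 3) * x 2 ^ 2) :=
      mul_pos hx (add_pos_of_pos_of_nonneg (by positivity)
        (mul_nonneg (by linarith) (by positivity)))
    linarith
  · have : 0 < (x 0 * (x 1 ^ 2 - x 2 ^ 2) + x 1 ^ 3) ^ 3 *
        (4 * (x 0 * (x 1 ^ 2 - x 2 ^ 2)) + 12 * (-x 1) * x 2 ^ 2) :=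
      mul_pos (pow_pos hx 3) (add_pos_of_pos_of_nonneg (by positivity)
        (mul_nonneg (by linarith) (by positivity)))
    linarith

theorem isHyperbolicOn_domain (s : Label) : IsHyperbolicOn (cubic s) (domain s) := by
  cases s
  exacts [isHyperbolicOn_a, isHyperbolicOn_b, isHyperbolicOn_c, isHyperbolicOn_d,
    isHyperbolicOn_e]

end Domains

/-! ### Images of the scalar curvature functions -/

section ScalarCurvature

open MvPolynomial

theorem isRiemannian_manifold (s : Label) : IsRiemannian (manifold s) (metric s) := by
  rw [manifold_eq]
  exact (isHyperbolicOn_domain s).isRiemannian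

theorem eval_det_hessian_pos (s : Label) {x : Fin 3 → ℝ} (hx : x ∈ domain s) :
    0 < eval x (hessian (cubic s)).det := by
  obtain ⟨hx, hr⟩ := hx
  cases s
  · rw [det_hessian_a]
    simp only [cubic, map_mul, eval_X, map_ofNat] at hx ⊢
    positivity
  · have h0 : 0 < x 0 := hr
    simp only [det_hessian_b, map_mul, map_pow, eval_X, map_ofNat]
    positivity
  · obtain ⟨h0, h1⟩ := hr
    have h5 := h0.ne
    rw [det_hessian_c]
    simp only [cubic, map_mul, map_pow, map_add, map_sub, eval_X, map_ofNat] at hx ⊢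
    have h2 : x 1 * x 2 + x 0 ^ 2 < 0 := neg_of_mul_pos_right hx h0.le
    have h4 : 0 < x 0 ^ 2 := by positivity
    have := mul_pos_of_neg_of_neg h0 (b := 2 * (x 1 * x 2 - 3 * x 0 ^ 2)) (by linarith)
    linarith
  · have h0 : x 2 < 0 := hr
    simp only [det_hessian_d, map_mul, map_pow, map_add, map_sub, map_neg, eval_X, map_ofNat]
    have h4 : 0 < x 2 ^ 2 := by have := h0.ne; positivity
    have := mul_pos (a := -8 * x 2) (b := x 0 ^ 2 + x 1 ^ 2 + 3 * x 2 ^ 2) (by linarith)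
      (by positivity)
    linarith
  · obtain ⟨h1, h0⟩ := hr
    rw [det_hessian_e]
    simp only [cubic, map_mul, map_pow, map_add, map_sub, eval_X, map_ofNat] at hx ⊢
    have h3 : x 1 ^ 3 < 0 := Odd.pow_neg (by decide) h1
    have := mul_nonneg (a := -x 1) (b := x 2 ^ 2) (by linarith) (by positivity)
    linarith

theorem scalImage_eq (s : Label) : scalImage s = (fun x => -(15 / 2) + eval x (cubic s) *
    hessianContraction (cubic s) x / eval x (hessian (cubic s)).det ^ 3) '' domain s := by
  have hscal {z : Fin 3 → ℂ} (hz : imPart z ∈ domain s) := (isHyperbolicOn_domain s).scal_rMetric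
    (isHomogeneous_cubic s) (fun x hx => (eval_det_hessian_pos s hx).ne') hz
  rw [scalImage, manifold_eq]
  ext r
  constructor
  · rintro ⟨z, hz, rfl⟩
    exact ⟨imPart z, hz, (hscal hz).symm⟩
  · rintro ⟨x, hx, rfl⟩
    -- The purely imaginary point i x lies over x, so nothing is lost by projecting to imaginary
    -- parts.
    have him : imPart (fun μ => Complex.I * (x μ : ℂ)) = x := by
      ext μ
      simp
    refine ⟨fun μ => Complex.I * (x μ : ℂ), by rwa [Set.mem_preimage, him], ?_⟩
    have := hscal (z := fun μ => Complex.I * (x μ : ℂ)) (by rwa [him])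
    rw [him] at this
    exact this

theorem scalImage_a : scalImage Label.a = {-6} := by
  rw [scalImage_eq]
  have hne : (domain Label.a).Nonempty :=
    ⟨fun _ => 1, by simp [cubic], by norm_num [region]⟩
  refine (Set.image_congr fun x hx => ?_).trans (hne.image_const (-6 : ℝ))
  have h0 : 0 < x 0 * x 1 * x 2 := by simpa [cubic] using hx.1
  rw [hessianContraction_a, det_hessian_a]
  simp only [cubic, map_mul, eval_X, map_ofNat]
  generalize x 0 * x 1 * x 2 = q at h0
  field_simp
  norm_num

theorem scalImage_b : scalImage Label.b = {-(15 / 2)} := by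
  rw [scalImage_eq]
  have hne : (domain Label.b).Nonempty :=
    ⟨![1, 1, 0], by simp [cubic], by norm_num [region]⟩
  refine (Set.image_congr fun x hx => ?_).trans (hne.image_const (-(15 / 2) : ℝ))
  rw [hessianContraction_b]
  simp

/-- The scalar curvature of the surfaces of type c) and d) is `-15/2 + 3/2 * profile u` for a
suitable parameter `u`. -/
def profile (u : ℝ) : ℝ := (1 - u) * (1 - 3 * u + 3 * u ^ 2)

theorem continuous_profile : Continuous profile := by
  unfold profile
  fun_prop

/-- Curvature is invariant under scaling x, and here depends only on the ratio of yz to x². The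
parameter is chosen with D as denominator: D = -2x(3x² - yz). -/
theorem scal_c_eq {x : Fin 3 → ℝ} (hx : x ∈ domain Label.c) :
    -(15 / 2) + eval x (cubic Label.c) * hessianContraction (cubic Label.c) x /
      eval x (hessian (cubic Label.c)).det ^ 3 =
    -(15 / 2) + 3 / 2 * profile (4 * x 0 ^ 2 / (3 * x 0 ^ 2 - x 1 * x 2)) := by
  have h0 : x 0 ≠ 0 := hx.2.1.ne
  have hD := (eval_det_hessian_pos _ hx).ne'
  rw [hessianContraction_c]
  rw [det_hessian_c] at hD ⊢
  simp only [cubic, map_mul, map_pow, map_add, map_sub, eval_X, map_ofNat] at hD ⊢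
  have hD' : 3 * x 0 ^ 2 - x 1 * x 2 ≠ 0 := fun h => hD (by linear_combination (-2 * x 0) * h)
  rw [show 2 * (x 0 * x 1 * x 2) - 6 * x 0 ^ 3 = -2 * x 0 * (3 * x 0 ^ 2 - x 1 * x 2) by ring,
    profile]
  obtain ⟨w, hw⟩ : ∃ w, x 1 * x 2 = 3 * x 0 ^ 2 - w := ⟨3 * x 0 ^ 2 - x 1 * x 2, by ring⟩
  rw [hw, sub_sub_cancel] at hD' ⊢
  field_simp
  ring

theorem scalImage_c : scalImage Label.c = Set.Ioo (-(15 / 2)) (-6) := by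
  rw [scalImage_eq, Set.image_congr fun x hx => scal_c_eq hx]
  ext r
  constructor
  · rintro ⟨x, ⟨hx, h0, h1⟩, rfl⟩
    have h5 : x 0 ≠ 0 := h0.ne
    have h4 : 0 < x 0 ^ 2 := by positivity
    have h2 : x 1 * x 2 + x 0 ^ 2 < 0 := by
      have : 0 < x 0 * (x 1 * x 2 + x 0 ^ 2) := by simpa [cubic] using hx
      exact neg_of_mul_pos_right this h0.le
    have h3 : 0 < 3 * x 0 ^ 2 - x 1 * x 2 := by linarith
    have hu : 0 < 4 * x 0 ^ 2 / (3 * x 0 ^ 2 - x 1 * x 2) := by positivity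
    have hu1 : 4 * x 0 ^ 2 / (3 * x 0 ^ 2 - x 1 * x 2) < 1 := by
      rw [div_lt_one h3]
      linarith
    beta_reduce
    generalize 4 * x 0 ^ 2 / (3 * x 0 ^ 2 - x 1 * x 2) = u at hu hu1 ⊢
    -- These products are `profile u` and 1 - `profile u`, giving the two bounds; both quadratic
    -- factors have negative discriminant.
    have e1 : 0 < (1 - u) * (1 - 3 * u + 3 * u ^ 2) :=
      mul_pos (by linarith) (by nlinarith [sq_nonneg (2 * u - 1)])
    have e2 : 0 < u * (4 - 6 * u + 3 * u ^ 2) :=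
      mul_pos hu (by nlinarith [sq_nonneg (u - 1)])
    simp only [Set.mem_Ioo, profile]
    constructor <;> linarith
  · rintro ⟨hr1, hr2⟩
    have hmem : (r + 15 / 2) * (2 / 3) ∈ Set.Ioo (profile 1) (profile 0) := by
      simp only [profile, Set.mem_Ioo]
      constructor <;> linarith
    obtain ⟨u, ⟨hu0, hu1⟩, hu⟩ :=
      intermediate_value_Ioo' zero_le_one continuous_profile.continuousOn hmem
    have hinv : 1 < 1 / u := by rwa [lt_div_iff₀ hu0, one_mul]
    -- Normalise x = -1, y = 1 and solve 4 / (3 - z) = u; then u < 1 means z < -1, which is h > 0.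
    refine ⟨![-1, 1, 3 - 4 / u], ⟨?_, ?_⟩, ?_⟩
    · have : 0 < -1 * (1 * (3 - 4 / u) + (-1) ^ 2) := by
        rw [show 4 / u = 4 * (1 / u) by ring]
        linarith
      simpa [cubic] using this
    · simp [region]
    · have h1 : 4 * (-1 : ℝ) ^ 2 / (3 * (-1) ^ 2 - 1 * (3 - 4 / u)) = u := by
        field_simp
        ring
      change -(15 / 2) + 3 / 2 * profile (4 * (-1 : ℝ) ^ 2 / (3 * (-1) ^ 2 - 1 * (3 - 4 / u))) = r
      rw [h1, hu]
      ring

theorem scal_d_eq {x : Fin 3 → ℝ} (hx : x ∈ domain Label.d) :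
    -(15 / 2) + eval x (cubic Label.d) * hessianContraction (cubic Label.d) x /
      eval x (hessian (cubic Label.d)).det ^ 3 =
    -(15 / 2) + 3 / 2 * profile (4 * x 2 ^ 2 / (3 * x 2 ^ 2 + (x 0 ^ 2 + x 1 ^ 2))) := by
  have h0 : x 2 ≠ 0 := ne_of_lt hx.2
  rw [hessianContraction_d, det_hessian_d]
  simp only [cubic, map_mul, map_pow, map_add, map_sub, map_neg, eval_X, map_ofNat]
  have hD : 3 * x 2 ^ 2 + (x 0 ^ 2 + x 1 ^ 2) ≠ 0 := by positivity
  rw [show -8 * (x 2 * (x 0 ^ 2 + x 1 ^ 2)) - 24 * x 2 ^ 3 =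
    -8 * x 2 * (3 * x 2 ^ 2 + (x 0 ^ 2 + x 1 ^ 2)) by ring, profile]
  obtain ⟨w, hw⟩ : ∃ w, x 0 ^ 2 + x 1 ^ 2 = w - 3 * x 2 ^ 2 :=
    ⟨3 * x 2 ^ 2 + (x 0 ^ 2 + x 1 ^ 2), by ring⟩
  rw [hw, add_sub_cancel] at hD ⊢
  field_simp
  ring

theorem scalImage_d : scalImage Label.d = Set.Ico (-(26 / 3)) (-(15 / 2)) := by
  rw [scalImage_eq, Set.image_congr fun x hx => scal_d_eq hx]
  ext r
  constructor
  · rintro ⟨x, ⟨hx, h0⟩, rfl⟩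
    replace h0 : x 2 < 0 := h0
    have h5 : x 2 ≠ 0 := h0.ne
    have h2 : x 0 ^ 2 + x 1 ^ 2 - x 2 ^ 2 < 0 := by
      have : 0 < x 2 * (x 0 ^ 2 + x 1 ^ 2 - x 2 ^ 2) := by simpa [cubic] using hx
      exact neg_of_mul_pos_right this h0.le
    have h3 : 0 < 3 * x 2 ^ 2 + (x 0 ^ 2 + x 1 ^ 2) := by positivity
    have hu : 1 < 4 * x 2 ^ 2 / (3 * x 2 ^ 2 + (x 0 ^ 2 + x 1 ^ 2)) := by
      rw [one_lt_div h3]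
      linarith
    have hu1 : 4 * x 2 ^ 2 / (3 * x 2 ^ 2 + (x 0 ^ 2 + x 1 ^ 2)) ≤ 4 / 3 := by
      rw [div_le_div_iff₀ h3 (by norm_num)]
      nlinarith [sq_nonneg (x 0), sq_nonneg (x 1)]
    beta_reduce
    generalize 4 * x 2 ^ 2 / (3 * x 2 ^ 2 + (x 0 ^ 2 + x 1 ^ 2)) = u at hu hu1 ⊢
    -- These products are -`profile u` and `profile u` + 7/9, where -7/9 is the value at the
    -- endpoint 4/3, reached on the axis x = y = 0.
    have e1 : 0 < (u - 1) * (1 - 3 * u + 3 * u ^ 2) :=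
      mul_pos (by linarith) (by nlinarith [sq_nonneg (2 * u - 1)])
    have e2 : 0 ≤ (4 / 3 - u) * (3 * u ^ 2 - 2 * u + 4 / 3) :=
      mul_nonneg (by linarith) (by nlinarith [sq_nonneg (u - 1)])
    simp only [Set.mem_Ico, profile]
    constructor <;> linarith
  · rintro ⟨hr1, hr2⟩
    have hmem : (r + 15 / 2) * (2 / 3) ∈ Set.Icc (profile (4 / 3)) (profile 1) := by
      simp only [profile, Set.mem_Icc]
      constructor <;> linarith
    obtain ⟨u, ⟨hu0, hu1⟩, hu⟩ :=
      intermediate_value_Icc' (by norm_num) continuous_profile.continuousOn hmem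
    -- `profile` vanishes at 1, whereas r < -15/2 requires a negative value.
    have hu0' : 1 < u := by
      refine lt_of_le_of_ne hu0 ?_
      rintro rfl
      simp only [profile] at hu
      linarith
    have hupos : 0 < u := by linarith
    have hinv : 4 / u < 4 := by rw [div_lt_iff₀ hupos]; linarith
    have hinv' : 3 ≤ 4 / u := by rw [le_div_iff₀ hupos]; linarith
    have hsq : √(4 / u - 3) ^ 2 = 4 / u - 3 := Real.sq_sqrt (by linarith)
    -- Normalise y = 0, z = -1 and solve 4 / (3 + x²) = u; the root is real because u ≤ 4/3.
    refine ⟨![√(4 / u - 3), 0, -1], ⟨?_, ?_⟩, ?_⟩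
    · have : 0 < -1 * (√(4 / u - 3) ^ 2 + 0 ^ 2 - (-1) ^ 2) := by
        rw [hsq]
        linarith
      simpa [cubic] using this
    · simp [region]
    · have h1 : 4 * (-1 : ℝ) ^ 2 / (3 * (-1) ^ 2 + (√(4 / u - 3) ^ 2 + 0 ^ 2)) = u := by
        rw [hsq]
        field_simp
        ring
      change -(15 / 2) + 3 / 2 *
        profile (4 * (-1 : ℝ) ^ 2 / (3 * (-1) ^ 2 + (√(4 / u - 3) ^ 2 + 0 ^ 2))) = r
      rw [h1, hu]
      ring

/-- On the points (1/q, -1, 0) the curvature is -15/2 + 3/2 (1 - 4q + 3q²). It tends to -6 as q → 0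
and equals -8 at q = 2/3, the minimum of the parabola; q < 1 keeps h = 1/q - 1 positive. -/
theorem Ico_subset_scalImage_e : Set.Ico (-8) (-6) ⊆ scalImage Label.e := by
  rw [scalImage_eq]
  rintro r ⟨hr1, hr2⟩
  have hmem : (r + 15 / 2) * (2 / 3) ∈ Set.Icc ((fun q : ℝ => 1 - 4 * q + 3 * q ^ 2) (2 / 3))
      ((fun q : ℝ => 1 - 4 * q + 3 * q ^ 2) 0) := by
    simp only [Set.mem_Icc]
    constructor <;> linarith
  obtain ⟨q, ⟨hq0, hq1⟩, hq⟩ := intermediate_value_Icc' (by norm_num)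
    (f := fun q : ℝ => 1 - 4 * q + 3 * q ^ 2) (Continuous.continuousOn (by fun_prop)) hmem
  have hq0' : 0 < q := by
    refine lt_of_le_of_ne hq0 ?_
    rintro rfl
    simp only at hq
    linarith
  have hinv : 1 < 1 / q := by rw [lt_div_iff₀ hq0']; linarith
  refine ⟨![1 / q, -1, 0], ⟨?_, ?_⟩, ?_⟩
  · have : 0 < 1 / q * ((-1) ^ 2 - 0 ^ 2) + (-1) ^ 3 := by linarith
    simpa [cubic] using this
  · exact ⟨by simp, by simpa using hq0'⟩
  · have h1 : -(15 / 2) + (1 / q * ((-1) ^ 2 - 0 ^ 2) + (-1) ^ 3) *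
        (768 * (1 / q * ((-1) ^ 2 - 0 ^ 2)) ^ 2 + 2304 * (1 / q) * (-1) * ((-1) ^ 4 - 0 ^ 4)
          + 13824 * (-1) ^ 4 * 0 ^ 2 + 2304 * 0 ^ 6) /
        (8 * (1 / q * ((-1) ^ 2 - 0 ^ 2)) - 24 * (-1 * 0 ^ 2)) ^ 3 =
        -(15 / 2) + 3 / 2 * (1 - 4 * q + 3 * q ^ 2) := by
      field_simp
      ring
    have h2 : -(15 / 2) + 3 / 2 * (1 - 4 * q + 3 * q ^ 2) = r := by
      simp only at hq
      rw [hq]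
      ring
    rw [← h2, ← h1]
    beta_reduce
    rw [hessianContraction_e, det_hessian_e]
    simp only [cubic, map_mul, map_pow, map_add, map_sub,
      eval_X, map_ofNat, Matrix.cons_val]

theorem scalImage_ne {s t : Label} (hst : s ≠ t) : scalImage s ≠ scalImage t := by
  intro h
  -- Among -6, -7, -8 the images of a), b), c), d) contain exactly -6, none, -7 and -8 respectively,
  -- while that of e) contains both -7 and -8. No information on -6 is needed for e).
  have h6 := Set.ext_iff.1 h (-6)
  have h7 := Set.ext_iff.1 h (-7)
  have h8 := Set.ext_iff.1 h (-8)
  have e7 : (-7 : ℝ) ∈ scalImage Label.e := Ico_subset_scalImage_e (by norm_num)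
  have e8 : (-8 : ℝ) ∈ scalImage Label.e := Ico_subset_scalImage_e (by norm_num)
  have hk := And.intro h6 (And.intro h7 h8)
  cases s <;> cases t <;> first
    | exact hst rfl
    | norm_num [scalImage_a, scalImage_b, scalImage_c, scalImage_d, e7, e8] at hk

end ScalarCurvature

end RMap

end

theorem proposition6p2 :
    (∀ s : RMap.Label, RMap.IsRiemannian (RMap.manifold s) (RMap.metric s)) ∧
    (∀ s t : RMap.Label, s ≠ t →
      ¬ RMap.Isometric (RMap.manifold s) (RMap.metric s) (RMap.manifold t) (RMap.metric t)) ∧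
    RMap.scalImage RMap.Label.a = {-6} ∧
    RMap.scalImage RMap.Label.b = {-(15 / 2)} ∧
    RMap.scalImage RMap.Label.c = Set.Ioo (-(15 / 2)) (-6) ∧
    RMap.scalImage RMap.Label.d = Set.Ico (-(26 / 3)) (-(15 / 2)) ∧
    Set.Ico (-8) (-6) ⊆ RMap.scalImage RMap.Label.e :=
  ⟨RMap.isRiemannian_manifold,
    fun s t hst h => RMap.scalImage_ne hst (h.image_scal_eq (RMap.isRiemannian_manifold s)
      (RMap.isRiemannian_manifold t)),
    RMap.scalImage_a, RMap.scalImage_b, RMap.scalImage_c, RMap.scalImage_d,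
    RMap.Ico_subset_scalImage_e⟩
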